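/- Let $\xi_0,\xi_1,\dots$ be independent standard complex Gaussian random variables (each with density $\frac1\pi e^{-|z|^2}$ on $\mathbb C$), let $f(z)=\sum_{k\ge 0}\xi_k\frac{z^k}{\sqrt{k!}}$ be the corresponding Gaussian entire function, and let $U(z)=\log|f(z)|-\frac12|z|^2$ be its random potential (with $U=-\infty$ at the zeros of $f$). For every $\beta>0$ there are constants $c>0$ and $\rho_0$, depending only on $\beta$, such that for all $\rho\ge\rho_0$ and all $M$ with $\log^2\rho\le M\le\rho^2$, the probability that there exists a curve $\gamma$ (the image of a continuous map $[0,1]\to\mathbb C$) contained in the disk $\{|z|\le\rho^4\}$, with $\operatorname{diam}(\gamma)\ge\beta\rho$ and $\max_\gamma U<-M$, does not exceed $e^{-c\rho M^{3/2}}$. -/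

import Mathlib

open MeasureTheory ProbabilityTheory

noncomputable section

/-- The law of a standard complex Gaussian variable: density `π⁻¹ exp (-|z|²)` with respect to
Lebesgue measure on the plane. -/
def stdComplexGaussian : Measure ℂ :=
  (volume : Measure ℂ).withDensity
    (fun z => ENNReal.ofReal (Real.pi⁻¹ * Real.exp (-‖z‖ ^ 2)))

/-- `ξ 0, ξ 1, …` are independent standard complex Gaussian variables on `(Ω, P)`. -/
structure IsIIDStdComplexGaussian {Ω : Type*} [MeasurableSpace Ω] (P : Measure Ω)
    (ξ : ℕ → Ω → ℂ) : Prop where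
  indep : iIndepFun ξ P
  law : ∀ k, HasLaw (ξ k) stdComplexGaussian P

/-- The Gaussian entire function `f(z) = ∑ ξ_k z^k / √(k!)` at the sample point `ω`.
The series converges absolutely at every `z`, for almost every `ω`. -/
def gaussianEntire {Ω : Type*} (ξ : ℕ → Ω → ℂ) (ω : Ω) (z : ℂ) : ℂ :=
  ∑' k : ℕ, ξ k ω * z ^ k / ((Real.sqrt (k.factorial : ℝ) : ℝ) : ℂ)

/-- The potential `U(z) = log |f(z)| - |z|² / 2`, with values in `[-∞, ∞]`; here `log 0 = -∞`,
so `U = -∞` at the zeros of `f`. -/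
def potential (f : ℂ → ℂ) (z : ℂ) : EReal :=
  ENNReal.log ‖f z‖ₑ - ((‖z‖ ^ 2 / 2 : ℝ) : EReal)

/-- There is a curve (continuous image of `[0,1]`) in the closed disk of radius `r` about `0`, of
diameter at least `d`, on which `U < -M` everywhere. As a curve is compact and, for continuous `f`,
`U` is upper semicontinuous, this is the same as saying that the maximum of `U` on the curve
is less than `-M`. -/
def ExistsLowCurve (f : ℂ → ℂ) (r d M : ℝ) : Prop :=
  ∃ γ : C(unitInterval, ℂ),
    (∀ t, γ t ∈ Metric.closedBall (0 : ℂ) r) ∧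
    d ≤ Metric.diam (Set.range γ) ∧
    ∀ t, potential f (γ t) < ((-M : ℝ) : EReal)

end

open scoped ComplexConjugate RealInnerProductSpace

/-! ### The standard complex Gaussian law -/

/-! Write f*(z) = f(z) exp(-|z|²/2), so that |f*| = e^U, and take the scale r = a√M with a small. A
low curve of diameter at least βρ carries N ≈ βρ/(24r) points spaced by at least 12r, and around
each of them a piece of curve reaching distance r.

Analytic half: smallness on such a piece spreads to a disk. Near a center w the Fock translate of f
is entire, has modulus |f*| up to a factor exp(|z|²/2), and is at most exp(-M + 2r²) on the piece.
Lagrange interpolation at n ≈ M/8 nodes loses only (8e)^n, while the Taylor remainder gains e^(-8n)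
(`norm_le_of_spread_nodes`). Hence |f*| ≤ e^(-M/4) on a disk of radius 2r about w
(`normalized_le_exp_of_low_curve`), and w may be taken from a unit net.

Probabilistic half: on a circle of radius r in each disk put L ≈ r² equidistributed points. The
covariance matrix of the NL values of f* is at least e^(-r²)/2: each circle is handled by
translation invariance and Parseval, and distinct circles are almost independent
(`fockKernel_lower_bound`). A Gaussian vector with such a covariance is at most e^(-M/4) in every
coordinate with probability at most e^(-NLM/4) (`IsIIDStdComplexGaussian.measure_small_on_circles`).

The choice of N centers costs a factor e^(NM/8) at most, so the exponent stays of order NLM ≈ ρrM ≈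
ρM^(3/2). The a priori growth bound on f fails only with doubly exponentially small probability. -/

lemma integral_stdComplexGaussian (f : ℂ → ℂ) :
    ∫ z, f z ∂stdComplexGaussian
      = (Real.pi : ℂ)⁻¹ * ∫ z, Complex.exp (-((‖z‖ : ℂ) ^ 2)) * f z := by
  unfold stdComplexGaussian
  rw [integral_withDensity_eq_integral_toReal_smul (by fun_prop) (by simp),
    ← integral_const_mul]
  refine integral_congr_ae (Filter.Eventually.of_forall fun z => ?_)
  have : 0 ≤ Real.pi⁻¹ * Real.exp (-‖z‖ ^ 2) := by positivity
  simp only [ENNReal.toReal_ofReal this, Complex.real_smul]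
  push_cast
  ring

instance isProbabilityMeasure_stdComplexGaussian :
    IsProbabilityMeasure stdComplexGaussian := by
  constructor
  have h := GaussianFourier.integral_rexp_neg_mul_sq_norm (V := ℂ) one_pos
  have hi : Integrable (fun z : ℂ => Real.exp (-‖z‖ ^ 2)) := by
    -- A non-integrable function has integral 0 by convention, which contradicts the value π.
    by_contra hc
    have h0 := integral_undef hc
    simp [h0] at h
    exact Real.pi_ne_zero h.symm
  simp only [stdComplexGaussian, withDensity_apply _ MeasurableSet.univ, Measure.restrict_univ]
  rw [← ofReal_integral_eq_lintegral_ofReal (hi.const_mul _)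
    (Filter.Eventually.of_forall fun z => by positivity), integral_const_mul]
  simp only [neg_mul, one_mul, div_one, Complex.finrank_real_complex, Nat.cast_ofNat,
    div_self (two_ne_zero' ℝ), Real.rpow_one] at h
  rw [h, inv_mul_cancel₀ Real.pi_ne_zero, ENNReal.ofReal_one]

lemma charFun_stdComplexGaussian (w : ℂ) :
    ∫ z, Complex.exp (Complex.I * (⟪w, z⟫ : ℝ)) ∂stdComplexGaussian
      = Complex.exp (-((‖w‖ : ℂ) ^ 2) / 4) := by
  have h := GaussianFourier.integral_cexp_neg_mul_sq_norm_add (V := ℂ) (b := 1) (by simp)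
    Complex.I w
  have hpi : (Real.pi : ℂ) ≠ 0 := by exact_mod_cast Real.pi_ne_zero
  rw [integral_stdComplexGaussian]
  simp only [← Complex.exp_add]
  simp only [neg_mul, one_mul, div_one, Complex.finrank_real_complex, Nat.cast_ofNat,
    div_self (two_ne_zero' ℂ), Complex.cpow_one, Complex.I_sq, mul_one] at h
  rw [h, ← mul_assoc, inv_mul_cancel₀ hpi, one_mul]

lemma integral_exp_neg_mul_sq_stdComplexGaussian {s : ℝ} (hs : -1 < s) :
    ∫ z, Complex.exp (-(s * (‖z‖ : ℂ) ^ 2)) ∂stdComplexGaussian = ((1 + s : ℝ) : ℂ)⁻¹ := by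
  have h := GaussianFourier.integral_cexp_neg_mul_sq_norm (V := ℂ) (b := 1 + s)
    (by simp; linarith)
  have hpi : (Real.pi : ℂ) ≠ 0 := by exact_mod_cast Real.pi_ne_zero
  rw [integral_stdComplexGaussian]
  simp only [← Complex.exp_add]
  simp only [Complex.finrank_real_complex, Nat.cast_ofNat,
    div_self (two_ne_zero' ℂ), Complex.cpow_one] at h
  have : (fun z : ℂ => Complex.exp (-(‖z‖ : ℂ) ^ 2 + -(s * (‖z‖ : ℂ) ^ 2)))
      = fun z : ℂ => Complex.exp (-(1 + s) * (‖z‖ : ℂ) ^ 2) := by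
    ext z; congr 1; ring
  rw [this, h]
  push_cast
  field_simp

lemma integral_rexp_neg_mul_sq_stdComplexGaussian {s : ℝ} (hs : -1 < s) :
    ∫ z, Real.exp (-(s * ‖z‖ ^ 2)) ∂stdComplexGaussian = (1 + s)⁻¹ := by
  have h := integral_exp_neg_mul_sq_stdComplexGaussian hs
  have : ∀ z : ℂ, Complex.exp (-(s * (‖z‖ : ℂ) ^ 2))
      = ((Real.exp (-(s * ‖z‖ ^ 2)) : ℝ) : ℂ) := fun z => by push_cast; rfl
  simp only [this] at h
  rw [integral_complex_ofReal] at h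
  exact_mod_cast h

lemma stdComplexGaussian_tail (u : ℝ) :
    stdComplexGaussian {z | u < ‖z‖ ^ 2} ≤ ENNReal.ofReal (2 * Real.exp (-u / 2)) := by
  -- Exponential Markov inequality: the mean of exp(|z|²/2) is 2.
  have h := integral_rexp_neg_mul_sq_stdComplexGaussian (s := -(1 / 2)) (by norm_num)
  have hi : Integrable (fun z : ℂ => Real.exp (-(-(1 / 2) * ‖z‖ ^ 2))) stdComplexGaussian := by
    by_contra hc
    rw [integral_undef hc] at h
    norm_num at h
  have hm := mul_meas_ge_le_integral_of_nonneg
    (Filter.Eventually.of_forall fun z => (Real.exp_pos _).le) hi (Real.exp (u / 2))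
  rw [h] at hm
  have hsub : {z : ℂ | u < ‖z‖ ^ 2}
      ⊆ {z : ℂ | Real.exp (u / 2) ≤ Real.exp (-(-(1 / 2) * ‖z‖ ^ 2))} := by
    intro z hz
    simp only [Set.mem_ofPred_eq, Real.exp_le_exp] at hz ⊢
    linarith
  refine (measure_mono hsub).trans ?_
  rw [← ENNReal.ofReal_toReal (measure_ne_top stdComplexGaussian _)]
  apply ENNReal.ofReal_le_ofReal
  change stdComplexGaussian.real _ ≤ _
  have he : Real.exp (u / 2) * Real.exp (-u / 2) = 1 := by
    rw [← Real.exp_add]; ring_nf; exact Real.exp_zero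
  calc _ = Real.exp (-u / 2) * (Real.exp (u / 2) * stdComplexGaussian.real
        {z : ℂ | Real.exp (u / 2) ≤ Real.exp (-(-(1 / 2) * ‖z‖ ^ 2))}) := by
        rw [← mul_assoc, mul_comm (Real.exp (-u / 2)), he, one_mul]
    _ ≤ Real.exp (-u / 2) * (1 + -(1 / 2))⁻¹ := by gcongr
    _ = _ := by norm_num; ring

/-! ### Gaussian duality and small balls in finite dimension -/

section Duality

variable {ι κ : Type*} [Fintype ι] [Fintype κ]

lemma charFun_pi_stdComplexGaussian (v : ι → ℂ) :
    ∫ z : ι → ℂ, Complex.exp (Complex.I * (∑ a, ⟪v a, z a⟫ : ℝ))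
        ∂(Measure.pi fun _ => stdComplexGaussian)
      = ((Real.exp (-(∑ a, ‖v a‖ ^ 2) / 4) : ℝ) : ℂ) := by
  have h : ∀ z : ι → ℂ, Complex.exp (Complex.I * (∑ a, ⟪v a, z a⟫ : ℝ))
      = ∏ a, Complex.exp (Complex.I * (⟪v a, z a⟫ : ℝ)) := fun z => by
    rw [← Complex.exp_sum]; push_cast; rw [Finset.mul_sum]
  simp only [h]
  rw [integral_fintype_prod_eq_prod (fun a (x : ℂ) => Complex.exp (Complex.I * (⟪v a, x⟫ : ℝ)))]
  simp only [charFun_stdComplexGaussian]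
  rw [← Complex.exp_sum, ← Finset.sum_div, Finset.sum_neg_distrib]
  push_cast
  rfl

/-- A Gaussian function of Φx is the characteristic function of a Gaussian vector z at 2tΦx. Fubini
and the symmetry ⟪Φx, z⟫ = ⟪x, Φ*z⟫ then exchange Φ for its adjoint. The point is that a lower bound
on Φ* is what a covariance bound supplies, and no determinant is needed. -/
lemma integral_exp_neg_sq_duality (φ : ι → κ → ℂ) (t : ℝ) :
    ∫ x : κ → ℂ, Real.exp (-(t ^ 2 * ∑ a, ‖∑ k, φ a k * x k‖ ^ 2))
        ∂(Measure.pi fun _ => stdComplexGaussian)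
      = ∫ z : ι → ℂ, Real.exp (-(t ^ 2 * ∑ k, ‖∑ a, conj (φ a k) * z a‖ ^ 2))
        ∂(Measure.pi fun _ => stdComplexGaussian) := by
  have e1 : ∀ x : κ → ℂ,
      ((Real.exp (-(t ^ 2 * ∑ a, ‖∑ k, φ a k * x k‖ ^ 2)) : ℝ) : ℂ)
      = ∫ z : ι → ℂ, Complex.exp (Complex.I * (∑ a, ⟪(2 * t) • ∑ k, φ a k * x k, z a⟫ : ℝ))
        ∂(Measure.pi fun _ => stdComplexGaussian) := fun x => by
    rw [charFun_pi_stdComplexGaussian]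
    congr 3
    simp only [norm_smul, mul_pow, ← Finset.mul_sum, Real.norm_eq_abs, sq_abs]
    ring
  have e2 : ∀ z : ι → ℂ,
      ((Real.exp (-(t ^ 2 * ∑ k, ‖∑ a, conj (φ a k) * z a‖ ^ 2)) : ℝ) : ℂ)
      = ∫ x : κ → ℂ,
        Complex.exp (Complex.I * (∑ k, ⟪(2 * t) • ∑ a, conj (φ a k) * z a, x k⟫ : ℝ))
        ∂(Measure.pi fun _ => stdComplexGaussian) := fun z => by
    rw [charFun_pi_stdComplexGaussian]
    congr 3
    simp only [norm_smul, mul_pow, ← Finset.mul_sum, Real.norm_eq_abs, sq_abs]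
    ring
  have e3 : ∀ (x : κ → ℂ) (z : ι → ℂ), ∑ a, ⟪(2 * t) • ∑ k, φ a k * x k, z a⟫
      = ∑ k, ⟪(2 * t) • ∑ a, conj (φ a k) * z a, x k⟫ := fun x z => by
    simp only [inner_smul_left, sum_inner, Finset.mul_sum, conj_trivial]
    rw [Finset.sum_comm]
    refine Finset.sum_congr rfl fun k _ => Finset.sum_congr rfl fun a _ => ?_
    simp only [Complex.inner, Complex.mul_re, Complex.mul_im, Complex.conj_re, Complex.conj_im,
      map_mul]
    ring
  apply Complex.ofReal_injective
  rw [← integral_complex_ofReal, ← integral_complex_ofReal]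
  simp only [e1, e2, e3]
  apply integral_integral_swap
  refine Integrable.of_bound (C := 1) ?_ (Filter.Eventually.of_forall fun p => ?_)
  · refine Continuous.aestronglyMeasurable ?_
    simp only [Function.uncurry_def]
    fun_prop
  · simp only [Function.uncurry_def, mul_comm Complex.I, Complex.norm_exp_ofReal_mul_I, le_refl]

lemma integral_exp_neg_mul_sum_sq (s : ℝ) (hs : 0 ≤ s) :
    ∫ z : ι → ℂ, Real.exp (-(s * ∑ a, ‖z a‖ ^ 2)) ∂(Measure.pi fun _ => stdComplexGaussian)
      = ((1 + s)⁻¹) ^ Fintype.card ι := by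
  have h : ∀ z : ι → ℂ, Real.exp (-(s * ∑ a, ‖z a‖ ^ 2))
      = ∏ a, Real.exp (-(s * ‖z a‖ ^ 2)) := fun z => by
    rw [← Real.exp_sum, Finset.mul_sum, Finset.sum_neg_distrib]
  simp only [h]
  rw [integral_fintype_prod_eq_pow (fun x : ℂ => Real.exp (-(s * ‖x‖ ^ 2))),
    integral_rexp_neg_mul_sq_stdComplexGaussian (by linarith)]

/-- Small ball estimate for a family of linear functionals of a Gaussian vector whose covariance
matrix is bounded below by `lam`. -/
lemma gaussian_small_ball (φ : ι → κ → ℂ) {lam ε : ℝ} (hlam : 0 < lam) (hε : 0 < ε)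
    (hφ : ∀ c : ι → ℂ, lam * ∑ a, ‖c a‖ ^ 2 ≤ ∑ k, ‖∑ a, c a * φ a k‖ ^ 2) :
    (Measure.pi fun _ : κ => stdComplexGaussian) {x | ∀ a, ‖∑ k, φ a k * x k‖ ≤ ε}
      ≤ ENNReal.ofReal ((Real.exp 1 * ε ^ 2 / lam) ^ Fintype.card ι) := by
  set μ : Measure (κ → ℂ) := Measure.pi fun _ : κ => stdComplexGaussian
  set d := Fintype.card ι
  set g : (κ → ℂ) → ℝ := fun x => Real.exp (-((ε⁻¹) ^ 2 * ∑ a, ‖∑ k, φ a k * x k‖ ^ 2)) with hg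
  have hgi : Integrable g μ := by
    refine Integrable.of_bound (C := 1) ?_ (Filter.Eventually.of_forall fun x => ?_)
    · refine Continuous.aestronglyMeasurable ?_
      simp only [hg]
      fun_prop
    · rw [Real.norm_of_nonneg (Real.exp_pos _).le, Real.exp_le_one_iff, neg_nonpos]
      positivity
  have hint : ∫ x, g x ∂μ ≤ ((1 + (ε⁻¹) ^ 2 * lam)⁻¹) ^ d := by
    rw [integral_exp_neg_sq_duality, ← integral_exp_neg_mul_sum_sq _ (by positivity)]
    refine integral_mono_of_nonneg (Filter.Eventually.of_forall fun x => (Real.exp_pos _).le)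
      ?_ (Filter.Eventually.of_forall fun z => ?_)
    · refine Integrable.of_bound (C := 1) ?_ (Filter.Eventually.of_forall fun x => ?_)
      · exact Continuous.aestronglyMeasurable (by fun_prop)
      · rw [Real.norm_of_nonneg (Real.exp_pos _).le, Real.exp_le_one_iff, neg_nonpos]
        positivity
    · simp only [Real.exp_le_exp, neg_le_neg_iff, mul_assoc]
      refine mul_le_mul_of_nonneg_left ?_ (by positivity)
      have := hφ fun a => conj (z a)
      simp only [RCLike.norm_conj] at this
      refine this.trans_eq (Finset.sum_congr rfl fun k _ => ?_)
      rw [← RCLike.norm_conj, map_sum]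
      simp [mul_comm]
  have hm := mul_meas_ge_le_integral_of_nonneg
    (Filter.Eventually.of_forall fun z => (Real.exp_pos _).le) hgi (Real.exp (-(d : ℝ)))
  -- With t = 1/ε the exponent on the event is at most d, so Markov's inequality costs e^d.
  have hsub : {x : κ → ℂ | ∀ a, ‖∑ k, φ a k * x k‖ ≤ ε} ⊆ {x | Real.exp (-(d : ℝ)) ≤ g x} := by
    intro x hx
    simp only [Set.mem_ofPred_eq, hg, Real.exp_le_exp, neg_le_neg_iff] at hx ⊢
    have : ∑ a, ‖∑ k, φ a k * x k‖ ^ 2 ≤ ∑ _a : ι, ε ^ 2 :=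
      Finset.sum_le_sum fun a _ => by have := hx a; gcongr
    rw [Finset.sum_const, Finset.card_univ, nsmul_eq_mul] at this
    calc _ ≤ (ε⁻¹) ^ 2 * (d * ε ^ 2) := by gcongr
      _ = d := by field_simp
  refine (measure_mono hsub).trans ?_
  rw [← ENNReal.ofReal_toReal (measure_ne_top μ _)]
  apply ENNReal.ofReal_le_ofReal
  change μ.real _ ≤ _
  have he : Real.exp (d : ℝ) * Real.exp (-(d : ℝ)) = 1 := by
    rw [← Real.exp_add, add_neg_cancel, Real.exp_zero]
  calc _ = Real.exp (d : ℝ) * (Real.exp (-(d : ℝ)) * μ.real {x | Real.exp (-(d : ℝ)) ≤ g x}) := by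
        rw [← mul_assoc, he, one_mul]
    _ ≤ Real.exp (d : ℝ) * ((1 + (ε⁻¹) ^ 2 * lam)⁻¹) ^ d := by gcongr; exact hm.trans hint
    _ = (Real.exp 1 * (1 + (ε⁻¹) ^ 2 * lam)⁻¹) ^ d := by
        rw [mul_pow, ← Real.exp_nat_mul, mul_one]
    _ ≤ _ := by
        rw [mul_div_assoc]
        gcongr
        rw [inv_le_comm₀ (by positivity) (by positivity), inv_div]
        have : (ε⁻¹) ^ 2 * lam = lam / ε ^ 2 := by field_simp
        rw [this]; linarith

end Duality

/-! ### Small ball estimate for random series -/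

section Series

variable {Ω : Type*} [MeasurableSpace Ω] {P : Measure Ω} [IsProbabilityMeasure P]
  {ξ : ℕ → Ω → ℂ} {ι : Type*} [Fintype ι]

lemma IsIIDStdComplexGaussian.map_eq_pi (h : IsIIDStdComplexGaussian P ξ) (m : ℕ) :
    P.map (fun ω (k : Fin m) => ξ k ω) = Measure.pi fun _ : Fin m => stdComplexGaussian := by
  have h1 : iIndepFun (fun (k : Fin m) => ξ k) P := h.indep.precomp Fin.val_injective
  rw [(iIndepFun_iff_map_fun_eq_pi_map fun k => (h.law _).aemeasurable).1 h1]
  congr 1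
  ext1 k
  exact (h.law k).map_eq

lemma IsIIDStdComplexGaussian.partial_small_ball (h : IsIIDStdComplexGaussian P ξ) (m : ℕ)
    (φ : ι → ℕ → ℂ) {lam ε : ℝ} (hlam : 0 < lam) (hε : 0 < ε)
    (hφ : ∀ c : ι → ℂ,
      lam * ∑ a, ‖c a‖ ^ 2 ≤ ∑ k ∈ Finset.range m, ‖∑ a, c a * φ a k‖ ^ 2) :
    P {ω | ∀ a, ‖∑ k ∈ Finset.range m, φ a k * ξ k ω‖ ≤ ε}
      ≤ ENNReal.ofReal ((Real.exp 1 * ε ^ 2 / lam) ^ Fintype.card ι) := by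
  have h1 := gaussian_small_ball (fun a (k : Fin m) => φ a k) hlam hε (fun c => by
    rw [Fin.sum_univ_eq_sum_range (fun k => ‖∑ a, c a * φ a k‖ ^ 2)]; exact hφ c)
  rw [← h.map_eq_pi m, Measure.map_apply_of_aemeasurable] at h1
  · convert h1 using 2
    ext ω
    simp only [Set.mem_ofPred_eq, Set.mem_preimage]
    refine forall_congr' fun a => ?_
    rw [Fin.sum_univ_eq_sum_range (fun k => φ a k * ξ k ω)]
  · exact aemeasurable_pi_lambda _ fun k => (h.law k).aemeasurable
  · have : {x : Fin m → ℂ | ∀ a, ‖∑ k : Fin m, φ a k * x k‖ ≤ ε}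
        = ⋂ a, {x : Fin m → ℂ | ‖∑ k : Fin m, φ a k * x k‖ ≤ ε} := by ext; simp
    rw [this]
    refine MeasurableSet.iInter fun a => (isClosed_le (by fun_prop) (by fun_prop)).measurableSet

lemma sum_normSq_sum_mul (φ : ι → ℕ → ℂ) (m : ℕ) (c : ι → ℂ) :
    ∑ k ∈ Finset.range m, ‖∑ a, c a * φ a k‖ ^ 2
      = (∑ a, ∑ b, c a * conj (c b) * ∑ k ∈ Finset.range m, φ a k * conj (φ b k)).re := by
  have : ∀ k, ‖∑ a, c a * φ a k‖ ^ 2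
      = (∑ a, ∑ b, c a * conj (c b) * (φ a k * conj (φ b k))).re := fun k => by
    rw [← Complex.normSq_eq_norm_sq, ← Complex.ofReal_re (Complex.normSq _), Complex.normSq_eq_conj_mul_self,
      map_sum, mul_comm, Finset.sum_mul_sum]
    congr 1
    refine Finset.sum_congr rfl fun a _ => Finset.sum_congr rfl fun b _ => ?_
    rw [map_mul]; ring
  simp only [this]
  rw [← Complex.re_sum, Finset.sum_comm]
  congr 1
  refine Finset.sum_congr rfl fun a _ => ?_
  rw [Finset.sum_comm]
  refine Finset.sum_congr rfl fun b _ => ?_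
  rw [Finset.mul_sum]

lemma abs_re_quadratic_le (K : ι → ι → ℂ) {δ : ℝ} (hK : ∀ a b, ‖K a b‖ ≤ δ) (c : ι → ℂ) :
    |(∑ a, ∑ b, c a * conj (c b) * K a b).re| ≤ δ * (∑ a, ‖c a‖) ^ 2 := by
  refine (Complex.abs_re_le_norm _).trans ?_
  calc _ ≤ ∑ a, ∑ b, ‖c a‖ * ‖c b‖ * δ := by
        refine (norm_sum_le _ _).trans (Finset.sum_le_sum fun a _ => (norm_sum_le _ _).trans
          (Finset.sum_le_sum fun b _ => ?_))
        rw [norm_mul, norm_mul, RCLike.norm_conj]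
        gcongr
        exact hK a b
    _ = _ := by
        rw [sq, Finset.sum_mul_sum, Finset.mul_sum]
        refine Finset.sum_congr rfl fun a _ => ?_
        rw [Finset.mul_sum]
        exact Finset.sum_congr rfl fun b _ => by ring

/-- The finitely many entries of the truncated covariance converge to those of K, and an entrywise
error δ changes the form by at most δ d ∑ |c a|². Half of `lam` therefore survives truncation,
uniformly in c. -/
lemma eventually_quadratic_lower_bound (φ : ι → ℕ → ℂ) (K : ι → ι → ℂ)
    (hK : ∀ a b, HasSum (fun k => φ a k * conj (φ b k)) (K a b)) {lam : ℝ} (hlam : 0 < lam)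
    (hQ : ∀ c : ι → ℂ, lam * ∑ a, ‖c a‖ ^ 2 ≤ (∑ a, ∑ b, c a * conj (c b) * K a b).re) :
    ∀ᶠ m : ℕ in Filter.atTop, ∀ c : ι → ℂ, lam / 2 * ∑ a, ‖c a‖ ^ 2
      ≤ ∑ k ∈ Finset.range m, ‖∑ a, c a * φ a k‖ ^ 2 := by
  set d : ℝ := (Fintype.card ι : ℝ) with hd
  have hd0 : 0 ≤ d := Nat.cast_nonneg _
  set δ : ℝ := lam / (2 * (d + 1)) with hδ
  have hδ0 : 0 < δ := by positivity
  have hev : ∀ᶠ m : ℕ in Filter.atTop, ∀ a b,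
      ‖K a b - ∑ k ∈ Finset.range m, φ a k * conj (φ b k)‖ ≤ δ := by
    rw [Filter.eventually_all]; intro a
    rw [Filter.eventually_all]; intro b
    have := (Metric.tendsto_nhds.1 (hK a b).tendsto_sum_nat) δ hδ0
    filter_upwards [this] with m hm
    rw [dist_comm, dist_eq_norm] at hm
    exact hm.le
  filter_upwards [hev] with m hm c
  rw [sum_normSq_sum_mul]
  have h1 := (abs_le.1 (abs_re_quadratic_le _ hm c)).2
  have h2 : (∑ a, ‖c a‖) ^ 2 ≤ d * ∑ a, ‖c a‖ ^ 2 := sq_sum_le_card_mul_sum_sq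
  have h3 : δ * (∑ a, ‖c a‖) ^ 2 ≤ lam / 2 * ∑ a, ‖c a‖ ^ 2 := by
    have hs : 0 ≤ ∑ a, ‖c a‖ ^ 2 := by positivity
    calc _ ≤ δ * (d * ∑ a, ‖c a‖ ^ 2) := by gcongr
      _ ≤ δ * ((d + 1) * ∑ a, ‖c a‖ ^ 2) := by gcongr; linarith
      _ = _ := by rw [hδ]; field_simp
  have h4 := hQ c
  simp only [mul_sub, Finset.sum_sub_distrib, Complex.sub_re] at h1
  linarith

/-- Small ball estimate for finitely many values of random series with Gaussian coefficients, in
terms of a lower bound on their covariance matrix `K`. -/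
lemma IsIIDStdComplexGaussian.series_small_ball (h : IsIIDStdComplexGaussian P ξ)
    (φ : ι → ℕ → ℂ) (K : ι → ι → ℂ)
    (hK : ∀ a b, HasSum (fun k => φ a k * conj (φ b k)) (K a b)) {lam ε : ℝ} (hlam : 0 < lam)
    (hε : 0 < ε)
    (hQ : ∀ c : ι → ℂ, lam * ∑ a, ‖c a‖ ^ 2 ≤ (∑ a, ∑ b, c a * conj (c b) * K a b).re)
    (X : ι → Ω → ℂ) (S : Set Ω)
    (hS : ∀ ω ∈ S, ∀ a, HasSum (fun k => φ a k * ξ k ω) (X a ω)) :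
    P {ω | ω ∈ S ∧ ∀ a, ‖X a ω‖ ≤ ε}
      ≤ ENNReal.ofReal ((8 * Real.exp 1 * ε ^ 2 / lam) ^ Fintype.card ι) := by
  obtain ⟨m₀, hm₀⟩ := Filter.eventually_atTop.1 (eventually_quadratic_lower_bound φ K hK hlam hQ)
  set A : ℕ → Set Ω := fun m => {ω | ∀ a, ‖∑ k ∈ Finset.range m, φ a k * ξ k ω‖ ≤ 2 * ε}
  have hA : ∀ m, m₀ ≤ m →
      P (A m) ≤ ENNReal.ofReal ((8 * Real.exp 1 * ε ^ 2 / lam) ^ Fintype.card ι) := fun m hm => by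
    refine (h.partial_small_ball m φ (half_pos hlam) (by positivity : 0 < 2 * ε)
      (hm₀ m hm)).trans_eq ?_
    congr 2
    field_simp
    norm_num
  -- Partial sums only converge to X, hence the slack 2ε. The event lies in the liminf of the A m,
  -- an increasing union of sets each inside some A m with m ≥ m₀.
  have hsub : {ω | ω ∈ S ∧ ∀ a, ‖X a ω‖ ≤ ε} ⊆ ⋃ n, ⋂ m ≥ n, A m := by
    rintro ω ⟨hω, hX⟩
    have hev : ∀ᶠ m : ℕ in Filter.atTop, ∀ a,
        ‖∑ k ∈ Finset.range m, φ a k * ξ k ω‖ ≤ 2 * ε := by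
      rw [Filter.eventually_all]; intro a
      have := (hS ω hω a).tendsto_sum_nat.norm
      exact (this.eventually_lt_const (by linarith [hX a] : ‖X a ω‖ < 2 * ε)).mono
        fun m hm => hm.le
    obtain ⟨n, hn⟩ := Filter.eventually_atTop.1 hev
    simp only [Set.mem_iUnion, Set.mem_iInter]
    exact ⟨n, hn⟩
  refine (measure_mono hsub).trans ?_
  rw [Monotone.measure_iUnion]
  · refine iSup_le fun n => (measure_mono ?_).trans (hA (max n m₀) (le_max_right _ _))
    exact Set.biInter_subset_of_mem (le_max_left n m₀ : max n m₀ ≥ n)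
  · intro n n' hn
    exact Set.biInter_subset_biInter_left fun m hm => le_trans hn hm

end Series

/-! ### Growth of the Gaussian entire function -/

/-- The threshold grows linearly in k, so the tail bounds form a geometric series of ratio e^(-1/2)
≤ 2/3. -/
lemma IsIIDStdComplexGaussian.measure_large_coeff {Ω : Type*} [MeasurableSpace Ω]
    {P : Measure Ω} {ξ : ℕ → Ω → ℂ} (h : IsIIDStdComplexGaussian P ξ) (T : ℝ) :
    P {ω | ¬ ∀ k : ℕ, ‖ξ k ω‖ ^ 2 ≤ T ^ 2 + k} ≤ ENNReal.ofReal (6 * Real.exp (-T ^ 2 / 2)) := by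
  set q : ℝ := Real.exp (-(1 / 2)) with hq
  have hq0 : 0 < q := Real.exp_pos _
  have hq1 : q ≤ 2 / 3 := by
    rw [hq, Real.exp_neg, inv_le_comm₀ (Real.exp_pos _) (by norm_num)]
    have := Real.add_one_le_exp (1 / 2 : ℝ)
    norm_num at this ⊢
    linarith
  have hU : {ω | ¬ ∀ k : ℕ, ‖ξ k ω‖ ^ 2 ≤ T ^ 2 + k}
      = ⋃ k : ℕ, {ω | T ^ 2 + k < ‖ξ k ω‖ ^ 2} := by
    ext ω; simp
  have hk : ∀ k : ℕ, P {ω | T ^ 2 + k < ‖ξ k ω‖ ^ 2}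
      ≤ ENNReal.ofReal (2 * Real.exp (-T ^ 2 / 2) * q ^ k) := fun k => by
    rw [(h.law k).measure_eq (p := fun z => T ^ 2 + k < ‖z‖ ^ 2)
      (isOpen_lt (by fun_prop) (by fun_prop)).measurableSet]
    refine (stdComplexGaussian_tail _).trans_eq ?_
    rw [hq, mul_assoc, ← Real.exp_nat_mul, ← Real.exp_add]
    congr 3
    ring
  have hs := (hasSum_geometric_of_lt_one hq0.le (by linarith)).mul_left
    (2 * Real.exp (-T ^ 2 / 2))
  rw [hU]
  refine (measure_iUnion_le _).trans ((ENNReal.tsum_le_tsum hk).trans ?_)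
  rw [← ENNReal.ofReal_tsum_of_nonneg (fun k => by positivity) hs.summable, hs.tsum_eq]
  apply ENNReal.ofReal_le_ofReal
  have : (1 - q)⁻¹ ≤ 3 := by
    rw [inv_le_comm₀ (by linarith) (by norm_num)]
    linarith
  nlinarith [Real.exp_pos (-T ^ 2 / 2)]

section Growth

variable {a : ℕ → ℂ} {T : ℝ}

/-- A summable majorant for the terms of the series `∑ a k * z ^ k / √(k!)` on `‖z‖ ≤ x`. -/
lemma exists_majorant (hT : 1 ≤ T) (ha : ∀ k : ℕ, ‖a k‖ ^ 2 ≤ T ^ 2 + k) (x : ℝ) :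
    ∃ u : ℕ → ℝ,
      HasSum u (T * Real.exp (x ^ 2 / 2) * (((x ^ 2 + 1) ^ 2 + Real.exp 1) / 2)) ∧
      ∀ k z, ‖z‖ ≤ x → ‖a k * z ^ k / ((Real.sqrt (k.factorial : ℝ) : ℝ) : ℂ)‖ ≤ u k := by
  -- Splitting x² = θy with 1 - θ = 1/y distributes x^(2k)/k! over a geometric and an exponential
  -- series. The weight s balances their sums, as e^y = e s².
  set y : ℝ := x ^ 2 + 1 with hy
  have hy1 : 1 ≤ y := by nlinarith [sq_nonneg x]
  set θ : ℝ := x ^ 2 / y with hθ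
  have hθ0 : 0 ≤ θ := by positivity
  have hθ1 : 1 - θ = y⁻¹ := by rw [hθ, hy]; field_simp; ring
  have hθlt : θ < 1 := by have : 0 < y⁻¹ := by positivity
                          linarith
  set s : ℝ := Real.exp (x ^ 2 / 2) with hs
  have hs0 : 0 < s := Real.exp_pos _
  have hss : s * s = Real.exp (x ^ 2) := by rw [hs, ← Real.exp_add]; congr 1; ring
  have h1 : HasSum (fun k : ℕ => ((k : ℝ) + 1) * θ ^ k) (y ^ 2) := by
    have hn : ‖θ‖ < 1 := by rwa [Real.norm_of_nonneg hθ0]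
    have e1 := hasSum_coe_mul_geometric_of_norm_lt_one hn
    have e2 := hasSum_geometric_of_lt_one hθ0 hθlt
    have e3 := e1.add e2
    rw [hθ1] at e3
    have hv : y ^ 2 = θ / y⁻¹ ^ 2 + y⁻¹⁻¹ := by rw [hθ, hy]; field_simp
    rw [hv]
    simp only [add_mul, one_mul]
    exact e3
  have h2 : HasSum (fun k : ℕ => y ^ k / k.factorial) (Real.exp y) := by
    rw [Real.exp_eq_exp_ℝ]; exact NormedSpace.expSeries_div_hasSum_exp y
  refine ⟨fun k => (T * (k + 1) * θ ^ k * s + T * (y ^ k / k.factorial) / s) / 2, ?_, ?_⟩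
  · have hv : T * s * ((y ^ 2 + Real.exp 1) / 2)
        = (T * s * y ^ 2 + T / s * Real.exp y) / 2 := by
      rw [hy, Real.exp_add, ← hss]; field_simp
    rw [hv]
    have hf : (fun k : ℕ => (T * (k + 1) * θ ^ k * s + T * (y ^ k / k.factorial) / s) / 2)
        = fun k : ℕ => (T * s * ((k + 1) * θ ^ k) + T / s * (y ^ k / k.factorial)) / 2 := by
      ext k; ring
    rw [hf]
    exact ((h1.mul_left (T * s)).add (h2.mul_left (T / s))).div_const 2
  · intro k z hz
    have hx : 0 ≤ x := (norm_nonneg z).trans hz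
    have hfac : (0 : ℝ) < k.factorial := by exact_mod_cast k.factorial_pos
    -- The squared term is at most a product of two summands; the arithmetic-geometric mean
    -- inequality bounds it by the square of their half-sum.
    refine abs_le_of_sq_le_sq' ?_ (by positivity) |>.2
    have e1 : ‖a k * z ^ k / ((Real.sqrt (k.factorial : ℝ) : ℝ) : ℂ)‖ ^ 2
        = ‖a k‖ ^ 2 * (‖z‖ ^ 2) ^ k / k.factorial := by
      rw [norm_div, norm_mul, norm_pow, div_pow, mul_pow, Complex.norm_real, Real.norm_eq_abs,
        sq_abs, Real.sq_sqrt hfac.le]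
      ring
    have e2 : ‖a k‖ ^ 2 ≤ T ^ 2 * (k + 1) := by
      have := ha k
      nlinarith [mul_nonneg (by nlinarith : 0 ≤ T ^ 2 - 1) (Nat.cast_nonneg k : (0 : ℝ) ≤ k)]
    have e3 : (θ * y) ^ k = (x ^ 2) ^ k := by rw [hθ]; field_simp
    rw [e1]
    calc ‖a k‖ ^ 2 * (‖z‖ ^ 2) ^ k / k.factorial
        ≤ T ^ 2 * (k + 1) * (x ^ 2) ^ k / k.factorial := by gcongr
      _ = (T * (k + 1) * θ ^ k * s) * (T * (y ^ k / k.factorial) / s) := by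
        rw [← e3, mul_pow]; field_simp
      _ ≤ _ := by
        nlinarith [sq_nonneg ((T * (k + 1) * θ ^ k * s) - (T * (y ^ k / k.factorial) / s))]

lemma hasSum_entire (hT : 1 ≤ T) (ha : ∀ k : ℕ, ‖a k‖ ^ 2 ≤ T ^ 2 + k) (z : ℂ) :
    HasSum (fun k : ℕ => a k * z ^ k / ((Real.sqrt (k.factorial : ℝ) : ℝ) : ℂ))
      (∑' k : ℕ, a k * z ^ k / ((Real.sqrt (k.factorial : ℝ) : ℝ) : ℂ)) := by
  obtain ⟨u, hu, hle⟩ := exists_majorant hT ha ‖z‖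
  exact (Summable.of_norm_bounded hu.summable fun k => hle k z le_rfl).hasSum

lemma norm_entire_le (hT : 1 ≤ T) (ha : ∀ k : ℕ, ‖a k‖ ^ 2 ≤ T ^ 2 + k) (z : ℂ) :
    ‖∑' k : ℕ, a k * z ^ k / ((Real.sqrt (k.factorial : ℝ) : ℝ) : ℂ)‖
      ≤ T * Real.exp (‖z‖ ^ 2 / 2) * (((‖z‖ ^ 2 + 1) ^ 2 + Real.exp 1) / 2) := by
  obtain ⟨u, hu, hle⟩ := exists_majorant hT ha ‖z‖
  exact tsum_of_norm_bounded hu fun k => hle k z le_rfl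

lemma differentiable_entire (hT : 1 ≤ T) (ha : ∀ k : ℕ, ‖a k‖ ^ 2 ≤ T ^ 2 + k) :
    Differentiable ℂ
      fun z : ℂ => ∑' k : ℕ, a k * z ^ k / ((Real.sqrt (k.factorial : ℝ) : ℝ) : ℂ) := by
  intro z
  obtain ⟨u, hu, hle⟩ := exists_majorant hT ha (‖z‖ + 1)
  have hd := Complex.differentiableOn_tsum_of_summable_norm
    (F := fun (k : ℕ) (z : ℂ) => a k * z ^ k / ((Real.sqrt (k.factorial : ℝ) : ℝ) : ℂ))
    hu.summable (fun k => by fun_prop) Metric.isOpen_ball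
    (fun k w (hw : w ∈ Metric.ball (0 : ℂ) (‖z‖ + 1)) =>
      hle k w (by simpa using (mem_ball_zero_iff.1 hw).le))
  exact hd.differentiableAt (Metric.isOpen_ball.mem_nhds (by simp))

end Growth

/-! ### Entire functions that are small on a well spread set of nodes -/

lemma prod_erase_abs_sub (n i : ℕ) (hi : i ≤ n) :
    ∏ j ∈ (Finset.range (n + 1)).erase i, |(i : ℝ) - j| = i.factorial * (n - i).factorial := by
  set g : ℕ → ℝ := fun j => if j = i then 1 else |(i : ℝ) - j| with hg
  have h1 : ∏ j ∈ (Finset.range (n + 1)).erase i, |(i : ℝ) - j|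
      = ∏ j ∈ Finset.range (n + 1), g j := by
    rw [← Finset.prod_erase (Finset.range (n + 1)) (f := g) (a := i) (by simp [hg])]
    refine Finset.prod_congr rfl fun j hj => ?_
    simp [hg, (Finset.mem_erase.1 hj).1]
  rw [h1]
  obtain ⟨m, rfl⟩ := Nat.exists_eq_add_of_le hi
  rw [show i + m + 1 = i + (m + 1) by ring, Finset.prod_range_add, Finset.prod_range_succ',
    Nat.add_sub_cancel_left]
  have e1 : ∏ j ∈ Finset.range i, g j = i.factorial := by
    rw [← Finset.prod_range_reflect, ← Finset.prod_range_add_one_eq_factorial]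
    push_cast
    refine Finset.prod_congr rfl fun j hj => ?_
    have hj' := Finset.mem_range.1 hj
    have hne : i - 1 - j ≠ i := by omega
    have hc : ((i - 1 - j : ℕ) : ℝ) = i - 1 - j := by
      rw [Nat.sub_sub, Nat.cast_sub (by omega)]; push_cast; ring
    simp only [hg, if_neg hne, hc]
    rw [abs_of_nonneg] <;> ring_nf
    positivity
  have e2 : ∏ k ∈ Finset.range m, g (i + (k + 1)) = m.factorial := by
    rw [← Finset.prod_range_add_one_eq_factorial]
    push_cast
    refine Finset.prod_congr rfl fun k _ => ?_
    have hne : i + (k + 1) ≠ i := by omega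
    simp only [hg, if_neg hne]
    push_cast
    rw [abs_sub_comm, abs_of_nonneg] <;> ring_nf
    positivity
  rw [e1, e2]
  simp [hg]

/-- A polynomial of degree at most `n` that is at most `η` at `n + 1` well spread nodes is
at most `(8 e) ^ n * η` on the disk containing the nodes. -/
lemma norm_eval_le_of_spread_nodes (p : Polynomial ℂ) (n : ℕ) (hn : 0 < n)
    (hp : p.degree < (n + 1 : ℕ)) (x : ℕ → ℂ) {r η : ℝ} (hr : 0 < r)
    (hx : ∀ i ≤ n, ‖x i‖ ≤ 2 * r)
    (hsep : ∀ i ≤ n, ∀ j ≤ n, r * |(i : ℝ) - j| / n ≤ ‖x i - x j‖)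
    (hη : ∀ i ≤ n, ‖p.eval (x i)‖ ≤ η) (z : ℂ) (hz : ‖z‖ ≤ 2 * r) :
    ‖p.eval z‖ ≤ (8 * Real.exp 1) ^ n * η := by
  have hn0 : (0 : ℝ) < n := by exact_mod_cast hn
  have hη0 : 0 ≤ η := (norm_nonneg _).trans (hη 0 (Nat.zero_le _))
  have hpos : ∀ i j : ℕ, i ≠ j → 0 < |(i : ℝ) - j| := fun i j hij =>
    abs_pos.2 (sub_ne_zero.2 (by exact_mod_cast hij))
  have hinj : Set.InjOn x (Finset.range (n + 1) : Finset ℕ) := by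
    intro i hi j hj hij
    simp only [Finset.coe_range, Set.mem_Iio] at hi hj
    by_contra hne
    have h1 := hsep i (by omega) j (by omega)
    rw [hij, sub_self, norm_zero] at h1
    have : 0 < r * |(i : ℝ) - j| / n := by have := hpos i j hne; positivity
    linarith
  rw [Lagrange.eq_interpolate (f := p) (s := Finset.range (n + 1)) (v := x) hinj (by simpa using hp),
    Lagrange.interpolate_apply, Polynomial.eval_finsetSum]
  -- In each Lagrange basis factor the numerator is at most 4r and the denominator at least r|i -
  -- j|/n. The products i!(n - i)! assemble into binomial coefficients of total 2^n, and n^n/n! ≤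
  -- e^n.
  have hb : ∀ i ∈ Finset.range (n + 1),
      ‖(Polynomial.C (p.eval (x i)) * Lagrange.basis (Finset.range (n + 1)) x i).eval z‖
        ≤ (4 * n : ℝ) ^ n / n.factorial * η * n.choose i := by
    intro i hi
    have hi' : i ≤ n := by have := Finset.mem_range.1 hi; omega
    rw [Polynomial.eval_mul, Polynomial.eval_C, norm_mul, Lagrange.basis, Polynomial.eval_prod,
      norm_prod]
    have hprod : ∏ j ∈ (Finset.range (n + 1)).erase i,
        ‖(Lagrange.basisDivisor (x i) (x j)).eval z‖
          ≤ (4 * n : ℝ) ^ n / (i.factorial * (n - i).factorial) := by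
      rw [← prod_erase_abs_sub n i hi']
      have hcard : ((Finset.range (n + 1)).erase i).card = n := by
        rw [Finset.card_erase_of_mem hi, Finset.card_range, Nat.add_sub_cancel]
      calc _ ≤ ∏ j ∈ (Finset.range (n + 1)).erase i, (4 * n / |(i : ℝ) - j|) := by
            refine Finset.prod_le_prod (fun _ _ => norm_nonneg _) fun j hj => ?_
            obtain ⟨hji, hj⟩ := Finset.mem_erase.1 hj
            have hj' : j ≤ n := by have := Finset.mem_range.1 hj; omega
            have hd := hpos i j (Ne.symm hji)
            have h1 : ‖z - x j‖ ≤ 4 * r := (norm_sub_le _ _).trans (by linarith [hx j hj'])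
            have h2 : 0 < r * |(i : ℝ) - j| / n := by positivity
            simp only [Lagrange.basisDivisor, Polynomial.eval_mul, Polynomial.eval_C,
              Polynomial.eval_sub, Polynomial.eval_X, norm_mul, norm_inv]
            calc _ ≤ (r * |(i : ℝ) - j| / n)⁻¹ * (4 * r) := by
                  gcongr
                  exact hsep i hi' j hj'
              _ = _ := by field_simp
        _ = _ := by rw [Finset.prod_div_distrib, Finset.prod_const, hcard]
    calc _ ≤ η * ((4 * n : ℝ) ^ n / (i.factorial * (n - i).factorial)) := by
          gcongr
          exact hη i hi'
      _ = _ := by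
          rw [Nat.cast_choose ℝ hi']
          have h1 : (n.factorial : ℝ) ≠ 0 := by exact_mod_cast n.factorial_ne_zero
          field_simp
  refine (norm_sum_le _ _).trans ((Finset.sum_le_sum hb).trans ?_)
  rw [← Finset.mul_sum, ← Nat.cast_sum, Nat.sum_range_choose]
  have hS := Real.pow_div_factorial_le_exp (x := n) hn0.le n
  calc _ = 8 ^ n * ((n : ℝ) ^ n / n.factorial) * η := by
        rw [mul_pow, show (8 : ℝ) = 4 * 2 by norm_num, mul_pow]; push_cast; ring
    _ ≤ 8 ^ n * Real.exp n * η := by gcongr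
    _ = _ := by rw [mul_pow, ← Real.exp_nat_mul, mul_one]

/-- F is replaced by its Taylor polynomial of degree n. By Cauchy's estimates on the disk of radius
2Kr the remainder is at most B K^(-n) on the disk of radius 2r. It enters twice: at the nodes,
amplified by interpolation, and at z. -/
lemma norm_le_of_spread_nodes {F : ℂ → ℂ} (hF : Differentiable ℂ F) (n : ℕ) (hn : 0 < n)
    (x : ℕ → ℂ) {r η B K : ℝ} (hr : 0 < r) (hK : 2 ≤ K)
    (hB : ∀ z, ‖z‖ ≤ 2 * K * r → ‖F z‖ ≤ B)
    (hx : ∀ i ≤ n, ‖x i‖ ≤ 2 * r)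
    (hsep : ∀ i ≤ n, ∀ j ≤ n, r * |(i : ℝ) - j| / n ≤ ‖x i - x j‖)
    (hη : ∀ i ≤ n, ‖F (x i)‖ ≤ η) (z : ℂ) (hz : ‖z‖ ≤ 2 * r) :
    ‖F z‖ ≤ (8 * Real.exp 1) ^ n * (η + 2 * B * (K⁻¹) ^ n) := by
  have hB0 : 0 ≤ B := (norm_nonneg _).trans (hB 0 (by rw [norm_zero]; positivity))
  have hK0 : 0 < K := by linarith
  set c : ℕ → ℂ := fun k => ((k.factorial : ℂ))⁻¹ * iteratedDeriv k F 0 with hc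
  have hcb : ∀ k, ‖c k‖ ≤ B / (2 * K * r) ^ k := fun k => by
    have h1 := Complex.norm_iteratedDeriv_le_of_forall_mem_sphere_norm_le k
      (by positivity : 0 < 2 * K * r) (hF.diffContOnCl (s := Metric.ball 0 (2 * K * r)))
      (C := B) (fun z hz => hB z (by simpa using (mem_sphere_zero_iff_norm.1 hz).le))
    have hk : (0 : ℝ) < k.factorial := by exact_mod_cast k.factorial_pos
    rw [hc, norm_mul, norm_inv, Complex.norm_natCast]
    calc _ ≤ (k.factorial : ℝ)⁻¹ * (k.factorial * B / (2 * K * r) ^ k) := by gcongr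
      _ = _ := by field_simp
  set p : Polynomial ℂ := ∑ k ∈ Finset.range (n + 1), Polynomial.monomial k (c k) with hp
  have hpe : ∀ w, p.eval w = ∑ k ∈ Finset.range (n + 1), c k * w ^ k := fun w => by
    simp [hp, Polynomial.eval_finsetSum]
  have hpd : p.degree < (n + 1 : ℕ) := by
    refine (Polynomial.degree_sum_le _ _).trans_lt ?_
    rw [Finset.sup_lt_iff (WithBot.bot_lt_coe _)]
    intro k hk
    exact (Polynomial.degree_monomial_le _ _).trans_lt
      (by exact_mod_cast Finset.mem_range.1 hk)
  have hrem : ∀ w, ‖w‖ ≤ 2 * r → ‖p.eval w - F w‖ ≤ B * (K⁻¹) ^ n := fun w hw => by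
    have hs : HasSum (fun k => c k * w ^ k) (F w) := by
      have := Complex.hasSum_taylorSeries_of_entire hF 0 w
      simp only [sub_zero, smul_eq_mul] at this
      have he : (fun k => c k * w ^ k)
          = fun k => ((k.factorial : ℂ))⁻¹ * (w ^ k * iteratedDeriv k F 0) := by
        ext k; rw [hc]; ring
      rw [he]
      exact this
    have hd := dist_le_of_le_geometric_of_tendsto (K⁻¹) B
      (f := fun n => ∑ k ∈ Finset.range n, c k * w ^ k)
      (inv_lt_one_of_one_lt₀ (by linarith)) (fun k => by
        rw [dist_comm, dist_eq_norm, Finset.sum_range_succ, add_sub_cancel_left, norm_mul, norm_pow]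
        calc _ ≤ B / (2 * K * r) ^ k * (2 * r) ^ k := by
              gcongr
              exact hcb k
          _ = _ := by rw [mul_right_comm, mul_pow (2 * r), inv_pow]; field_simp) hs.tendsto_sum_nat (n + 1)
    rw [dist_eq_norm] at hd
    rw [hpe]
    refine hd.trans ?_
    -- The tail starts at degree n + 1; the extra factor 1/K pays for 1/(1 - 1/K).
    have h1 : K⁻¹ ≤ 1 / 2 := by rw [inv_le_comm₀ hK0 (by norm_num)]; linarith
    rw [div_le_iff₀ (by linarith), pow_succ]
    have : 0 ≤ B * K⁻¹ ^ n := by positivity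
    nlinarith
  have hpz := norm_eval_le_of_spread_nodes p n hn hpd x hr hx hsep
    (η := η + B * (K⁻¹) ^ n) (fun i hi => by
      have h1 := hrem _ (hx i hi)
      have h2 := norm_le_insert' (p.eval (x i)) (F (x i))
      linarith [hη i hi]) z hz
  have h1 := hrem z hz
  have h2 := norm_le_insert (p.eval z) (F z)
  have h3 : (1 : ℝ) ≤ (8 * Real.exp 1) ^ n := by
    apply one_le_pow₀
    have := Real.add_one_le_exp (1 : ℝ)
    linarith
  have h4 : 0 ≤ B * (K⁻¹) ^ n := by positivity
  nlinarith

/-! ### The covariance of the normalized values of the Gaussian entire function -/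

/-- The covariance `𝔼 f*(p) conj (f*(q))` of `f*(z) = f(z) exp (-‖z‖² / 2)`. -/
noncomputable def fockKernel (p q : ℂ) : ℂ :=
  Complex.exp (p * conj q - (‖p‖ : ℂ) ^ 2 / 2 - (‖q‖ : ℂ) ^ 2 / 2)

/-- The coefficient of `ξ k` in `f(p) exp (-‖p‖² / 2)`. -/
noncomputable def fockCoeff (p : ℂ) (k : ℕ) : ℂ :=
  Complex.exp (-(‖p‖ : ℂ) ^ 2 / 2) * (p ^ k / ((Real.sqrt (k.factorial : ℝ) : ℝ) : ℂ))

lemma hasSum_fockKernel (p q : ℂ) :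
    HasSum (fun k => fockCoeff p k * conj (fockCoeff q k)) (fockKernel p q) := by
  have h := (NormedSpace.expSeries_div_hasSum_exp (p * conj q)).mul_left
    (Complex.exp (-(‖p‖ : ℂ) ^ 2 / 2) * Complex.exp (-(‖q‖ : ℂ) ^ 2 / 2))
  rw [← Complex.exp_eq_exp_ℂ, ← Complex.exp_add, ← Complex.exp_add] at h
  have he : fockKernel p q
      = Complex.exp (-(‖p‖ : ℂ) ^ 2 / 2 + -(‖q‖ : ℂ) ^ 2 / 2 + p * conj q) := by
    rw [fockKernel]; congr 1; ring
  rw [he]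
  have hf : (fun k => fockCoeff p k * conj (fockCoeff q k)) = fun k : ℕ =>
      Complex.exp (-(‖p‖ : ℂ) ^ 2 / 2 + -(‖q‖ : ℂ) ^ 2 / 2)
        * ((p * conj q) ^ k / (k.factorial : ℂ)) := by
    ext k
    have hs : ((Real.sqrt (k.factorial : ℝ) : ℝ) : ℂ) * ((Real.sqrt (k.factorial : ℝ) : ℝ) : ℂ)
        = (k.factorial : ℂ) := by
      rw [← Complex.ofReal_mul, Real.mul_self_sqrt (Nat.cast_nonneg _), Complex.ofReal_natCast]
    simp only [fockCoeff, map_mul, map_div₀, map_pow, Complex.conj_ofReal, ← Complex.exp_conj,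
      map_neg, map_ofNat]
    rw [← hs, Complex.exp_add, mul_pow]
    ring
  rw [hf]
  exact h

lemma norm_fockKernel (p q : ℂ) : ‖fockKernel p q‖ = Real.exp (-‖p - q‖ ^ 2 / 2) := by
  rw [fockKernel, Complex.norm_exp]
  congr 1
  simp only [← Complex.ofReal_pow, ← Complex.normSq_eq_norm_sq, Complex.normSq_apply,
    Complex.sub_re, Complex.mul_re, Complex.conj_re, Complex.conj_im, Complex.sub_im,
    Complex.div_ofNat_re, Complex.ofReal_re]
  ring

/-- Translation multiplies the covariance by unimodular phases only. They can be absorbed into the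
coefficients of a quadratic form, so every circle may be centered at 0. -/
lemma fockKernel_add (w z z' : ℂ) :
    fockKernel (w + z) (w + z')
      = Complex.exp (((z * conj w).im : ℂ) * Complex.I)
        * conj (Complex.exp (((z' * conj w).im : ℂ) * Complex.I)) * fockKernel z z' := by
  simp only [fockKernel, ← Complex.exp_conj, ← Complex.exp_add]
  congr 1
  apply Complex.ext
  · simp only [← Complex.ofReal_pow, ← Complex.normSq_eq_norm_sq, Complex.normSq_apply,
      Complex.sub_re, Complex.mul_re, Complex.conj_re, Complex.conj_im, Complex.add_re,
      Complex.add_im, Complex.mul_im, map_mul, Complex.conj_ofReal, Complex.conj_I,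
      Complex.div_ofNat_re, Complex.ofReal_re, Complex.ofReal_im, Complex.neg_re, Complex.neg_im,
      Complex.I_re, Complex.I_im, map_add]
    ring
  · simp only [← Complex.ofReal_pow, ← Complex.normSq_eq_norm_sq, Complex.normSq_apply,
      Complex.sub_im, Complex.conj_re, Complex.conj_im, Complex.add_re,
      Complex.add_im, Complex.mul_im, map_mul, Complex.conj_ofReal, Complex.conj_I,
      Complex.div_ofNat_im, Complex.ofReal_re, Complex.ofReal_im, Complex.neg_re, Complex.neg_im,
      Complex.I_re, Complex.I_im, map_add]
    ring

/-- The columns of the discrete Fourier matrix are orthogonal, each of squared norm L. -/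
lemma parseval_roots_of_unity {L : ℕ} {ω : ℂ} (hω : IsPrimitiveRoot ω L) (hL : L ≠ 0)
    (b : Fin L → ℂ) :
    ∑ k ∈ Finset.range L, ‖∑ s, b s * (ω ^ (s : ℕ)) ^ k‖ ^ 2 = L * ∑ s, ‖b s‖ ^ 2 := by
  have hn : ∀ m : ℕ, ‖ω ^ m‖ = 1 := fun m => by
    rw [norm_pow, hω.norm'_eq_one hL, one_pow]
  have horth : ∀ s t : Fin L,
      ∑ k ∈ Finset.range L, (ω ^ (s : ℕ)) ^ k * conj ((ω ^ (t : ℕ)) ^ k)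
        = if t = s then (L : ℂ) else 0 := fun s t => by
    have hk : ∀ k : ℕ, (ω ^ (s : ℕ)) ^ k * conj ((ω ^ (t : ℕ)) ^ k)
        = (ω ^ (s : ℕ) * conj (ω ^ (t : ℕ))) ^ k := fun k => by rw [map_pow, mul_pow]
    simp only [hk]
    have hinv : conj (ω ^ (t : ℕ)) = (ω ^ (t : ℕ))⁻¹ := by
      rw [Complex.inv_def, Complex.normSq_eq_norm_sq, hn]; simp
    rw [hinv]
    have hne : ω ^ (t : ℕ) ≠ 0 := fun h0 => by simpa [h0] using hn t
    split_ifs with hst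
    · subst hst
      simp [mul_inv_cancel₀ hne]
    · set x := ω ^ (s : ℕ) * (ω ^ (t : ℕ))⁻¹ with hx
      have hx1 : x ≠ 1 := by
        intro h1
        rw [hx, ← div_eq_mul_inv, div_eq_one_iff_eq hne] at h1
        exact hst (Fin.ext (hω.pow_inj t.2 s.2 h1.symm))
      have hxL : x ^ L = 1 := by
        rw [hx, mul_pow, inv_pow, pow_right_comm ω s, pow_right_comm ω t, hω.pow_eq_one]
        simp
      rw [geom_sum_eq hx1, hxL, sub_self, zero_div]
  rw [sum_normSq_sum_mul (fun (s : Fin L) k => (ω ^ (s : ℕ)) ^ k)]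
  simp only [horth, mul_ite, mul_zero, Finset.sum_ite_eq', Finset.mem_univ, if_true]
  rw [Complex.re_sum, Finset.mul_sum]
  refine Finset.sum_congr rfl fun s _ => ?_
  rw [Complex.mul_conj, ← Complex.ofReal_natCast, ← Complex.ofReal_mul, Complex.ofReal_re,
    Complex.normSq_eq_norm_sq]
  ring

/-- For a circle about 0 the form is a sum over Taylor modes k of nonnegative terms. The modes k < L
alone suffice: each has weight e^(-r²) r^(2k)/k! ≥ e^(-r²), since k! ≤ k^k ≤ r^(2k), and Parseval
sums them. -/
lemma fockKernel_circle_lower_bound {L : ℕ} {ω : ℂ} (hω : IsPrimitiveRoot ω L) (hL : L ≠ 0)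
    {r : ℝ} (hr : 0 < r) (hLr : (L : ℝ) ≤ r ^ 2) (w : ℂ) (c : Fin L → ℂ) :
    L * Real.exp (-r ^ 2) * ∑ s, ‖c s‖ ^ 2
      ≤ (∑ s, ∑ t, c s * conj (c t)
          * fockKernel (w + r * ω ^ (s : ℕ)) (w + r * ω ^ (t : ℕ))).re := by
  have hn : ∀ m : ℕ, ‖ω ^ m‖ = 1 := fun m => by
    rw [norm_pow, hω.norm'_eq_one hL, one_pow]
  have hn' : ∀ m : ℕ, ‖(r : ℂ) * ω ^ m‖ = r := fun m => by
    rw [norm_mul, hn, mul_one, Complex.norm_real, Real.norm_of_nonneg hr.le]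
  set z : Fin L → ℂ := fun s => r * ω ^ (s : ℕ) with hz
  set u : Fin L → ℂ := fun s => Complex.exp (((z s * conj w).im : ℂ) * Complex.I) with hu
  set b : Fin L → ℂ := fun s => c s * u s with hb
  have hbn : ∀ s, ‖b s‖ = ‖c s‖ := fun s => by
    rw [hb, norm_mul, hu, Complex.norm_exp_ofReal_mul_I, mul_one]
  have hQ : (∑ s, ∑ t, c s * conj (c t) * fockKernel (w + z s) (w + z t))
      = ∑ s, ∑ t, b s * conj (b t) * fockKernel (z s) (z t) := by
    refine Finset.sum_congr rfl fun s _ => Finset.sum_congr rfl fun t _ => ?_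
    rw [fockKernel_add, hb, map_mul]
    ring
  rw [hQ]
  have hlim : Filter.Tendsto
      (fun m : ℕ => ∑ k ∈ Finset.range m, ‖∑ s, b s * fockCoeff (z s) k‖ ^ 2) Filter.atTop
      (nhds (∑ s, ∑ t, b s * conj (b t) * fockKernel (z s) (z t)).re) := by
    simp only [sum_normSq_sum_mul (fun s k => fockCoeff (z s) k)]
    refine (Complex.continuous_re.tendsto _).comp ?_
    exact tendsto_finsetSum _ fun s _ => tendsto_finsetSum _ fun t _ =>
      (hasSum_fockKernel (z s) (z t)).tendsto_sum_nat.const_mul _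
  refine ge_of_tendsto hlim ?_
  filter_upwards [Filter.eventually_ge_atTop L] with m hm
  refine le_trans ?_ (Finset.sum_le_sum_of_subset_of_nonneg (Finset.range_mono hm)
    fun _ _ _ => by positivity)
  have hpar := parseval_roots_of_unity hω hL b
  simp only [hbn] at hpar
  rw [mul_right_comm, ← hpar, Finset.sum_mul]
  refine Finset.sum_le_sum fun k hk => ?_
  have hk' : (k : ℝ) ≤ r ^ 2 := by
    have : (k : ℝ) ≤ L := by exact_mod_cast (Finset.mem_range.1 hk).le
    linarith
  have hfac : (0 : ℝ) < k.factorial := by exact_mod_cast k.factorial_pos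
  have hone : 1 ≤ (r ^ 2) ^ k / k.factorial := by
    rw [one_le_div hfac]
    calc (k.factorial : ℝ) ≤ (k : ℝ) ^ k := by exact_mod_cast k.factorial_le_pow
      _ ≤ _ := by gcongr
  have hterm : ∑ s, b s * fockCoeff (z s) k
      = (Complex.exp (-(r : ℂ) ^ 2 / 2) * (r ^ k / ((Real.sqrt (k.factorial : ℝ) : ℝ) : ℂ)))
        * ∑ s, b s * (ω ^ (s : ℕ)) ^ k := by
    rw [Finset.mul_sum]
    refine Finset.sum_congr rfl fun s _ => ?_
    simp only [fockCoeff, hz, hn', mul_pow]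
    ring
  have he : ‖Complex.exp (-(r : ℂ) ^ 2 / 2)‖ ^ 2 = Real.exp (-r ^ 2) := by
    rw [Complex.norm_exp, ← Real.exp_nat_mul]
    congr 1
    simp only [← Complex.ofReal_pow, ← Complex.ofReal_neg, Complex.div_ofNat_re,
      Complex.ofReal_re]
    push_cast; ring
  rw [hterm, norm_mul, norm_mul, mul_pow, mul_pow, he, norm_div, div_pow, Complex.norm_real,
    Real.norm_eq_abs, sq_abs, Real.sq_sqrt hfac.le, norm_pow, Complex.norm_real,
    Real.norm_of_nonneg hr.le, ← pow_mul, mul_comm k 2, pow_mul]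
  calc _ = Real.exp (-r ^ 2) * 1 * ‖∑ s, b s * (ω ^ (s : ℕ)) ^ k‖ ^ 2 := by ring
    _ ≤ _ := by gcongr

/-- The values of `f*` on equidistributed points of well separated circles have a covariance
matrix bounded below. -/
lemma fockKernel_lower_bound {N L : ℕ} {ω : ℂ} (hω : IsPrimitiveRoot ω L) (hL : L ≠ 0)
    {r : ℝ} (hr : 0 < r) (hLr : (L : ℝ) ≤ r ^ 2) (w : Fin N → ℂ)
    (hsep : ∀ i j, i ≠ j → 10 * r ≤ ‖w i - w j‖) (hN : N * Real.exp (-31 * r ^ 2) ≤ 1 / 2)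
    (c : Fin N × Fin L → ℂ) :
    Real.exp (-r ^ 2) / 2 * ∑ a, ‖c a‖ ^ 2
      ≤ (∑ a, ∑ b, c a * conj (c b)
          * fockKernel (w a.1 + r * ω ^ (a.2 : ℕ)) (w b.1 + r * ω ^ (b.2 : ℕ))).re := by
  set p : Fin N × Fin L → ℂ := fun a => w a.1 + r * ω ^ (a.2 : ℕ) with hp
  -- K1 is the part within circles and K2 the interaction between different circles.
  set K1 : Fin N × Fin L → Fin N × Fin L → ℂ :=
    fun a b => if a.1 = b.1 then fockKernel (p a) (p b) else 0 with hK1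
  set K2 : Fin N × Fin L → Fin N × Fin L → ℂ :=
    fun a b => if a.1 = b.1 then 0 else fockKernel (p a) (p b) with hK2
  have hn : ∀ m : ℕ, ‖(r : ℂ) * ω ^ m‖ = r := fun m => by
    rw [norm_mul, norm_pow, hω.norm'_eq_one hL, one_pow, mul_one, Complex.norm_real,
      Real.norm_of_nonneg hr.le]
  have hsplit : (∑ a, ∑ b, c a * conj (c b) * fockKernel (p a) (p b))
      = (∑ a, ∑ b, c a * conj (c b) * K1 a b) + ∑ a, ∑ b, c a * conj (c b) * K2 a b := by
    simp only [← Finset.sum_add_distrib, ← mul_add]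
    refine Finset.sum_congr rfl fun a _ => Finset.sum_congr rfl fun b _ => ?_
    simp only [hK1, hK2]
    split_ifs <;> simp
  have hdiag : L * Real.exp (-r ^ 2) * ∑ a, ‖c a‖ ^ 2
      ≤ (∑ a, ∑ b, c a * conj (c b) * K1 a b).re := by
    have : (∑ a, ∑ b, c a * conj (c b) * K1 a b) = ∑ j, ∑ s, ∑ t, c (j, s) * conj (c (j, t))
        * fockKernel (w j + r * ω ^ (s : ℕ)) (w j + r * ω ^ (t : ℕ)) := by
      simp only [Fintype.sum_prod_type, hK1, hp, mul_ite, mul_zero]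
      refine Finset.sum_congr rfl fun j _ => Finset.sum_congr rfl fun s _ => ?_
      rw [Finset.sum_comm]
      simp
    rw [this, Complex.re_sum, Fintype.sum_prod_type, Finset.mul_sum]
    exact Finset.sum_le_sum fun j _ =>
      fockKernel_circle_lower_bound hω hL hr hLr (w j) fun s => c (j, s)
  -- Points of different circles are at distance at least 10r - 2r = 8r, so the kernel is at most
  -- exp(-32r²).
  have hoff := (abs_le.1 (abs_re_quadratic_le K2 (δ := Real.exp (-32 * r ^ 2))
    (fun a b => by
      simp only [hK2]
      split_ifs with hab
      · rw [norm_zero]; positivity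
      · rw [norm_fockKernel, Real.exp_le_exp]
        have h1 : w a.1 - w b.1 = (p a - p b) - r * ω ^ (a.2 : ℕ) + r * ω ^ (b.2 : ℕ) := by
          simp only [hp]; ring
        have h2 := hsep _ _ hab
        rw [h1] at h2
        have h3 := norm_add_le ((p a - p b) - r * ω ^ (a.2 : ℕ)) (r * ω ^ (b.2 : ℕ))
        have h4 := norm_sub_le (p a - p b) (r * ω ^ (a.2 : ℕ))
        rw [hn] at h3 h4
        have h5 : 8 * r ≤ ‖p a - p b‖ := by linarith
        nlinarith) c)).1
  have hcs : (∑ a, ‖c a‖) ^ 2 ≤ (N * L : ℝ) * ∑ a, ‖c a‖ ^ 2 := by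
    have := sq_sum_le_card_mul_sum_sq (s := (Finset.univ : Finset (Fin N × Fin L)))
      (f := fun a => ‖c a‖)
    simpa using this
  have hS : 0 ≤ ∑ a, ‖c a‖ ^ 2 := by positivity
  set S := ∑ a, ‖c a‖ ^ 2
  have hexp : Real.exp (-32 * r ^ 2) = Real.exp (-31 * r ^ 2) * Real.exp (-r ^ 2) := by
    rw [← Real.exp_add]; congr 1; ring
  have hL1 : (1 : ℝ) ≤ L := by exact_mod_cast Nat.one_le_iff_ne_zero.2 hL
  have hoff' : Real.exp (-32 * r ^ 2) * (∑ a, ‖c a‖) ^ 2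
      ≤ 1 / 2 * (L * Real.exp (-r ^ 2) * S) := by
    calc _ ≤ Real.exp (-32 * r ^ 2) * ((N * L : ℝ) * S) := by gcongr
      _ = (N * Real.exp (-31 * r ^ 2)) * (L * Real.exp (-r ^ 2) * S) := by rw [hexp]; ring
      _ ≤ _ := by gcongr
  rw [hsplit, Complex.add_re]
  have hfin : Real.exp (-r ^ 2) / 2 * S ≤ 1 / 2 * (L * Real.exp (-r ^ 2) * S) := by
    have : 0 ≤ Real.exp (-r ^ 2) * S := by positivity
    nlinarith
  linarith

/-! ### From a curve of low potential to a disk of low potential -/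

lemma norm_mul_exp_le_of_potential_lt {f : ℂ → ℂ} {z : ℂ} {M : ℝ}
    (h : potential f z < ((-M : ℝ) : EReal)) :
    ‖f z‖ * Real.exp (-‖z‖ ^ 2 / 2) ≤ Real.exp (-M) := by
  have h1 : ENNReal.log ‖f z‖ₑ < ((-M + ‖z‖ ^ 2 / 2 : ℝ) : EReal) := by
    have := (EReal.sub_lt_iff (Or.inl (EReal.coe_ne_bot _)) (Or.inl (EReal.coe_ne_top _))).1 h
    rwa [← EReal.coe_add] at this
  have h2 : ‖f z‖ₑ < ENNReal.ofReal (Real.exp (-M + ‖z‖ ^ 2 / 2)) := by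
    rw [← ENNReal.exp_log ‖f z‖ₑ, ← EReal.exp_coe]
    exact EReal.exp_strictMono h1
  rw [← ofReal_norm, ENNReal.ofReal_lt_ofReal_iff (Real.exp_pos _)] at h2
  calc _ ≤ Real.exp (-M + ‖z‖ ^ 2 / 2) * Real.exp (-‖z‖ ^ 2 / 2) := by gcongr
    _ = _ := by rw [← Real.exp_add]; congr 1; ring

lemma exists_norm_sub_eq (γ : C(unitInterval, ℂ)) (z : ℂ) {s : ℝ} {t₀ t₁ : unitInterval}
    (h₀ : ‖γ t₀ - z‖ ≤ s) (h₁ : s ≤ ‖γ t₁ - z‖) : ∃ t, ‖γ t - z‖ = s :=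
  mem_range_of_exists_le_of_exists_ge (f := fun t => ‖γ t - z‖) (by fun_prop) ⟨t₀, h₀⟩ ⟨t₁, h₁⟩

lemma exists_lt_norm_sub {γ : C(unitInterval, ℂ)} {d : ℝ} (hd : 0 < d)
    (h : d ≤ Metric.diam (Set.range γ)) : ∃ t₀ t₁, d / 2 < ‖γ t₁ - γ t₀‖ := by
  by_contra! hc
  have : Metric.diam (Set.range γ) ≤ d / 2 := by
    refine Metric.diam_le_of_forall_dist_le (by linarith) ?_
    rintro _ ⟨t, rfl⟩ _ ⟨t', rfl⟩
    rw [dist_eq_norm]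
    exact hc t' t
  linarith

/-- The Fock space translate of an entire function. -/
lemma norm_fock_translate (f : ℂ → ℂ) (w z : ℂ) :
    ‖f (w + z) * Complex.exp (-z * conj w - (‖w‖ : ℂ) ^ 2 / 2)‖
      = ‖f (w + z)‖ * Real.exp (-‖w + z‖ ^ 2 / 2) * Real.exp (‖z‖ ^ 2 / 2) := by
  rw [norm_mul, mul_assoc, ← Real.exp_add, Complex.norm_exp]
  congr 2
  simp only [← Complex.ofReal_pow, ← Complex.normSq_eq_norm_sq, Complex.normSq_apply,
    Complex.sub_re, Complex.mul_re, Complex.conj_re, Complex.conj_im, Complex.add_re,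
    Complex.add_im, Complex.neg_re, Complex.neg_im, Complex.div_ofNat_re, Complex.ofReal_re]
  ring

/-- By the intermediate value theorem the curve meets each circle of radius r i/n about γ(t₀). The
reverse triangle inequality makes these points spread nodes for the Fock translate of f at w,
whatever the shape of the curve. -/
lemma normalized_le_of_low_curve {f : ℂ → ℂ} (hf : Differentiable ℂ f)
    {γ : C(unitInterval, ℂ)} {M r B K R : ℝ} (hr : 1 ≤ r) (hK : 2 ≤ K)
    (hB : ∀ z, ‖z‖ ≤ R → ‖f z‖ * Real.exp (-‖z‖ ^ 2 / 2) ≤ B)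
    (hγ : ∀ t, potential f (γ t) < ((-M : ℝ) : EReal)) {t₀ t₁ : unitInterval}
    (ht : r ≤ ‖γ t₁ - γ t₀‖) {w : ℂ} (hw : ‖w - γ t₀‖ ≤ 1) (hwR : ‖w‖ + 2 * K * r ≤ R)
    {n : ℕ} (hn : 0 < n) {z : ℂ} (hz : ‖z‖ ≤ 2 * r) :
    ‖f (w + z)‖ * Real.exp (-‖w + z‖ ^ 2 / 2)
      ≤ (8 * Real.exp 1) ^ n
        * (Real.exp (-M + 2 * r ^ 2) + 2 * (B * Real.exp (2 * K ^ 2 * r ^ 2)) * (K⁻¹) ^ n) := by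
  have hr0 : 0 < r := by linarith
  have hn0 : (0 : ℝ) < n := by exact_mod_cast hn
  have hex : ∀ i : ℕ, ∃ t, i ≤ n → ‖γ t - γ t₀‖ = r * i / n := fun i => by
    by_cases hi : i ≤ n
    · have hin : (i : ℝ) ≤ n := by exact_mod_cast hi
      obtain ⟨t, ht⟩ := exists_norm_sub_eq γ (γ t₀) (s := r * i / n) (t₀ := t₀) (t₁ := t₁)
        (by rw [sub_self, norm_zero]; positivity)
        (le_trans (by rw [div_le_iff₀ hn0]; gcongr) ht)
      exact ⟨t, fun _ => ht⟩
    · exact ⟨t₀, fun h => absurd h hi⟩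
  choose τ hτ using hex
  set F : ℂ → ℂ := fun z => f (w + z) * Complex.exp (-z * conj w - (‖w‖ : ℂ) ^ 2 / 2) with hF
  have hFd : Differentiable ℂ F := by
    have : Differentiable ℂ fun z => f (w + z) := hf.comp (differentiable_id.const_add w)
    exact this.mul (by fun_prop)
  have hxle : ∀ i ≤ n, ‖γ (τ i) - w‖ ≤ 2 * r := fun i hi => by
    have hin : (i : ℝ) ≤ n := by exact_mod_cast hi
    have h1 : r * i / n ≤ r := by rw [div_le_iff₀ hn0]; gcongr
    have h2 := norm_sub_le_norm_sub_add_norm_sub (γ (τ i)) (γ t₀) w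
    rw [hτ i hi, norm_sub_rev (γ t₀)] at h2
    linarith
  have key := norm_le_of_spread_nodes hFd n hn (fun i => γ (τ i) - w) (r := r) (K := K)
    (η := Real.exp (-M + 2 * r ^ 2)) (B := B * Real.exp (2 * K ^ 2 * r ^ 2)) hr0 hK
    (fun z hz => by
      rw [hF, norm_fock_translate]
      have h1 := hB (w + z) ((norm_add_le _ _).trans (by linarith))
      have h2 : ‖z‖ ^ 2 / 2 ≤ 2 * K ^ 2 * r ^ 2 := by
        have : ‖z‖ ^ 2 ≤ (2 * K * r) ^ 2 := by gcongr
        nlinarith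
      have h3 : 0 ≤ ‖f (w + z)‖ * Real.exp (-‖w + z‖ ^ 2 / 2) := by positivity
      have h4 : 0 ≤ B := h3.trans h1
      gcongr)
    hxle
    (fun i hi j hj => by
      rw [sub_sub_sub_cancel_right]
      have h1 := abs_norm_sub_norm_le (γ (τ i) - γ t₀) (γ (τ j) - γ t₀)
      rw [sub_sub_sub_cancel_right, hτ i hi, hτ j hj, ← sub_div, ← mul_sub, abs_div, abs_mul,
        abs_of_pos hr0, abs_of_pos hn0] at h1
      exact h1)
    (fun i hi => by
      rw [hF, norm_fock_translate, add_sub_cancel, Real.exp_add]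
      have h1 := norm_mul_exp_le_of_potential_lt (hγ (τ i))
      have h2 : ‖γ (τ i) - w‖ ^ 2 / 2 ≤ 2 * r ^ 2 := by
        have : ‖γ (τ i) - w‖ ^ 2 ≤ (2 * r) ^ 2 := by gcongr; exact hxle i hi
        nlinarith
      gcongr) z hz
  refine le_trans ?_ key
  rw [hF, norm_fock_translate]
  exact le_mul_of_one_le_right (by positivity) (Real.one_le_exp (by positivity))

/-- If the potential of `f` is below `-M` on a curve, it is below `-M / 4` on a disk of radius
comparable to `√M` near each point of the curve. -/
lemma normalized_le_exp_of_low_curve {f : ℂ → ℂ} (hf : Differentiable ℂ f)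
    {γ : C(unitInterval, ℂ)} {M r R : ℝ} (hM : 50 ≤ M) (hr : 1 ≤ r)
    (hrM : 100 * Real.exp 16 * r ^ 2 ≤ M)
    (hB : ∀ z, ‖z‖ ≤ R → ‖f z‖ * Real.exp (-‖z‖ ^ 2 / 2) ≤ Real.exp (M / 50))
    (hγ : ∀ t, potential f (γ t) < ((-M : ℝ) : EReal)) {t₀ t₁ : unitInterval}
    (ht : r ≤ ‖γ t₁ - γ t₀‖) {w : ℂ} (hw : ‖w - γ t₀‖ ≤ 1)
    (hwR : ‖w‖ + 2 * Real.exp 8 * r ≤ R) {z : ℂ} (hz : ‖z‖ ≤ 2 * r) :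
    ‖f (w + z)‖ * Real.exp (-‖w + z‖ ^ 2 / 2) ≤ Real.exp (-M / 4) := by
  have he1 : (2 : ℝ) ≤ Real.exp 1 := by linarith [Real.add_one_le_exp (1 : ℝ)]
  have he8 : (2 : ℝ) ≤ Real.exp 8 := by linarith [Real.add_one_le_exp (8 : ℝ)]
  -- Interpolation then costs (8e)^n ≤ e^(4n) ≤ e^(M/2), while the remainder gains e^(-8n) ≤
  -- e^(8-M). Both terms end near e^(-M/2), with room for the lower-order factors.
  set n := ⌊M / 8⌋₊ with hn
  have hn1 : (n : ℝ) ≤ M / 8 := Nat.floor_le (by linarith)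
  have hn2 : M / 8 < n + 1 := Nat.lt_floor_add_one _
  have hn0 : 0 < n := Nat.floor_pos.2 (by linarith)
  refine (normalized_le_of_low_curve hf hr he8 hB hγ ht hw hwR hn0 hz).trans ?_
  have h8 : 8 * Real.exp 1 ≤ Real.exp 4 := by
    have : Real.exp 4 = Real.exp 1 ^ 3 * Real.exp 1 := by
      rw [← Real.exp_nat_mul, ← Real.exp_add]; norm_num
    rw [this]
    have h2 : (2 : ℝ) ^ 3 ≤ Real.exp 1 ^ 3 := by gcongr
    nlinarith [Real.exp_pos 1]
  have hA : (8 * Real.exp 1) ^ n ≤ Real.exp (M / 2) := by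
    calc _ ≤ Real.exp 4 ^ n := by gcongr
      _ = Real.exp (n * 4) := by rw [Real.exp_nat_mul]
      _ ≤ _ := Real.exp_le_exp.2 (by linarith)
  have hKn : ((Real.exp 8)⁻¹) ^ n ≤ Real.exp (8 - M) := by
    rw [← Real.exp_neg, ← Real.exp_nat_mul]
    exact Real.exp_le_exp.2 (by linarith)
  have h16 : Real.exp 8 ^ 2 = Real.exp 16 := by rw [← Real.exp_nat_mul]; norm_num
  have h1 : Real.exp (2 * Real.exp 8 ^ 2 * r ^ 2) ≤ Real.exp (M / 50) := by
    rw [h16]; exact Real.exp_le_exp.2 (by linarith)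
  have h2 : Real.exp (-M + 2 * r ^ 2) ≤ Real.exp (-M + M / 25) := by
    refine Real.exp_le_exp.2 ?_
    have : (1 : ℝ) ≤ Real.exp 16 := Real.one_le_exp (by norm_num)
    nlinarith [sq_nonneg r]
  have h10 : 1 + 2 * Real.exp 8 ≤ Real.exp 10 := by
    have : Real.exp 10 = Real.exp 1 ^ 2 * Real.exp 8 := by
      rw [← Real.exp_nat_mul, ← Real.exp_add]; norm_num
    rw [this]
    have h2 : (2 : ℝ) ^ 2 ≤ Real.exp 1 ^ 2 := by gcongr
    nlinarith [Real.exp_pos 8]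
  calc _ ≤ Real.exp (M / 2) * (Real.exp (-M + M / 25)
        + 2 * (Real.exp (M / 50) * Real.exp (M / 50)) * Real.exp (8 - M)) := by gcongr
    _ = (1 + 2 * Real.exp 8) * Real.exp (-M / 2 + M / 25) := by
        rw [mul_assoc 2, ← Real.exp_add, ← Real.exp_add, mul_add, ← Real.exp_add, mul_left_comm,
          ← Real.exp_add, add_mul, mul_assoc, ← Real.exp_add, one_mul]
        ring_nf
    _ ≤ Real.exp 10 * Real.exp (-M / 2 + M / 25) := by gcongr
    _ ≤ _ := by rw [← Real.exp_add]; exact Real.exp_le_exp.2 (by linarith)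

/-- Gaussian integers serve as the net. The curve depends on the sample point, so a union bound
needs finitely many candidate centers. -/
lemma exists_unit_net (R : ℝ) (hR : 0 ≤ R) :
    ∃ V : Finset ℂ, (V.card : ℝ) ≤ (2 * R + 5) ^ 2 ∧
      ∀ z : ℂ, ‖z‖ ≤ R → ∃ v ∈ V, ‖v - z‖ ≤ 1 := by
  classical
  set b : ℤ := ⌈R⌉ + 1 with hb
  have hbR : (b : ℝ) ≤ R + 2 := by rw [hb]; push_cast; linarith [Int.ceil_lt_add_one R]
  have hRb : R + 1 ≤ b := by rw [hb]; push_cast; linarith [Int.le_ceil R]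
  have hb0 : 0 ≤ b := by rw [hb]; have := Int.ceil_nonneg hR; omega
  have hmem : ∀ y : ℝ, |y| ≤ R → round y ∈ Finset.Icc (-b) b := fun y hy => by
    have h1 := abs_le.1 (abs_sub_round y)
    have h2 := abs_le.1 hy
    rw [Finset.mem_Icc]
    constructor
    · have : ((-b : ℤ) : ℝ) ≤ round y := by push_cast; linarith
      exact_mod_cast this
    · have : (round y : ℝ) ≤ b := by linarith
      exact_mod_cast this
  refine ⟨(Finset.Icc (-b) b ×ˢ Finset.Icc (-b) b).image fun q => (⟨q.1, q.2⟩ : ℂ), ?_, ?_⟩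
  · refine (Nat.cast_le.2 Finset.card_image_le).trans ?_
    have hc : (((Finset.Icc (-b) b).card : ℕ) : ℝ) = 2 * b + 1 := by
      rw [Int.card_Icc]
      have : (((b + 1 - -b).toNat : ℤ) : ℝ) = 2 * b + 1 := by
        rw [Int.toNat_of_nonneg (by omega)]; push_cast; ring
      exact_mod_cast this
    rw [Finset.card_product]
    push_cast
    rw [hc, ← sq]
    have : (0 : ℝ) ≤ b := by exact_mod_cast hb0
    exact pow_le_pow_left₀ (by positivity) (by linarith) 2
  · intro z hz
    refine ⟨⟨round z.re, round z.im⟩, Finset.mem_image.2 ⟨(round z.re, round z.im), ?_, rfl⟩, ?_⟩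
    · exact Finset.mem_product.2 ⟨hmem _ ((Complex.abs_re_le_norm z).trans hz),
        hmem _ ((Complex.abs_im_le_norm z).trans hz)⟩
    · refine (Complex.norm_le_abs_re_add_abs_im _).trans ?_
      simp only [Complex.sub_re, Complex.sub_im]
      rw [abs_sub_comm, abs_sub_comm _ z.im]
      linarith [abs_sub_round z.re, abs_sub_round z.im]

/-! ### Probability that the potential is low on many circles -/

lemma IsIIDStdComplexGaussian.measure_small_on_circles {Ω : Type*} [MeasurableSpace Ω]
    {P : Measure Ω} [IsProbabilityMeasure P] {ξ : ℕ → Ω → ℂ} (h : IsIIDStdComplexGaussian P ξ)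
    {N L : ℕ} {ω₀ : ℂ} (hω : IsPrimitiveRoot ω₀ L) (hL : L ≠ 0) {M r T : ℝ} (hT : 1 ≤ T)
    (hr : 0 < r) (hM : 50 ≤ M) (hrM : 100 * r ^ 2 ≤ M) (hLr : (L : ℝ) ≤ r ^ 2) (w : Fin N → ℂ)
    (hsep : ∀ i j, i ≠ j → 10 * r ≤ ‖w i - w j‖) (hN : N * Real.exp (-31 * r ^ 2) ≤ 1 / 2) :
    P {ω | (∀ k : ℕ, ‖ξ k ω‖ ^ 2 ≤ T ^ 2 + k) ∧ ∀ a : Fin N × Fin L,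
        ‖gaussianEntire ξ ω (w a.1 + r * ω₀ ^ (a.2 : ℕ))‖
          * Real.exp (-‖w a.1 + r * ω₀ ^ (a.2 : ℕ)‖ ^ 2 / 2) ≤ Real.exp (-M / 4)}
      ≤ ENNReal.ofReal (Real.exp (-M / 4) ^ (N * L)) := by
  set p : Fin N × Fin L → ℂ := fun a => w a.1 + r * ω₀ ^ (a.2 : ℕ) with hp
  have hX : ∀ a ω, ‖Complex.exp (-(‖p a‖ : ℂ) ^ 2 / 2) * gaussianEntire ξ ω (p a)‖
      = ‖gaussianEntire ξ ω (p a)‖ * Real.exp (-‖p a‖ ^ 2 / 2) := fun a ω => by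
    rw [norm_mul, mul_comm, Complex.norm_exp]
    congr 2
    simp only [← Complex.ofReal_pow, ← Complex.ofReal_neg, Complex.div_ofNat_re,
      Complex.ofReal_re]
  have key := h.series_small_ball (fun a k => fockCoeff (p a) k)
    (fun a b => fockKernel (p a) (p b)) (fun a b => hasSum_fockKernel _ _)
    (lam := Real.exp (-r ^ 2) / 2) (ε := Real.exp (-M / 4)) (by positivity) (by positivity)
    (fockKernel_lower_bound hω hL hr hLr w hsep hN)
    (fun a ω => Complex.exp (-(‖p a‖ : ℂ) ^ 2 / 2) * gaussianEntire ξ ω (p a))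
    {ω | ∀ k : ℕ, ‖ξ k ω‖ ^ 2 ≤ T ^ 2 + k} (fun ω hω a => by
      have := (hasSum_entire (a := fun k => ξ k ω) hT hω (p a)).mul_left
        (Complex.exp (-(‖p a‖ : ℂ) ^ 2 / 2))
      have he : (fun k => fockCoeff (p a) k * ξ k ω) = fun k : ℕ =>
          Complex.exp (-(‖p a‖ : ℂ) ^ 2 / 2)
            * (ξ k ω * p a ^ k / ((Real.sqrt (k.factorial : ℝ) : ℝ) : ℂ)) := by
        ext k; rw [fockCoeff]; ring
      rw [he]
      exact this)
  simp only [hX, Fintype.card_prod, Fintype.card_fin] at key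
  refine key.trans (ENNReal.ofReal_le_ofReal ?_)
  gcongr
  have he1 : (2 : ℝ) ≤ Real.exp 1 := by linarith [Real.add_one_le_exp (1 : ℝ)]
  have h16 : (16 : ℝ) ≤ Real.exp 4 := by
    have : Real.exp 4 = Real.exp 1 ^ 4 := by rw [← Real.exp_nat_mul]; norm_num
    rw [this]
    have h2 : (2 : ℝ) ^ 4 ≤ Real.exp 1 ^ 4 := by gcongr
    linarith
  -- Per point, the small ball factor is 16e·exp(-M/2 + r²); as r² ≤ M/100 and M ≥ 50, half of the
  -- exponent M/2 is left over.
  calc _ = 16 * (Real.exp 1 * Real.exp (-M / 4) ^ 2 * Real.exp (r ^ 2)) := by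
        rw [Real.exp_neg (r ^ 2)]; field_simp; norm_num
    _ ≤ Real.exp 4 * (Real.exp 1 * Real.exp (-M / 4) ^ 2 * Real.exp (r ^ 2)) := by gcongr
    _ = Real.exp (4 + 1 + 2 * (-M / 4) + r ^ 2) := by
        rw [← Real.exp_nat_mul]
        simp only [Real.exp_add]
        push_cast
        ring
    _ ≤ _ := Real.exp_le_exp.2 (by linarith)

/-- The curve has points at distances 12rj from γ(t₀), hence pairwise at least 12r apart. Moving
each to the net costs at most 1 ≤ r, which leaves 10r. -/
lemma exists_separated_small_disks {f : ℂ → ℂ} (hf : Differentiable ℂ f) {M r R d : ℝ}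
    (hM : 50 ≤ M) (hr : 1 ≤ r) (hrM : 100 * Real.exp 16 * r ^ 2 ≤ M) (hrd : 4 * r ≤ d)
    (hB : ∀ z, ‖z‖ ≤ R + 1 + 2 * Real.exp 8 * r →
      ‖f z‖ * Real.exp (-‖z‖ ^ 2 / 2) ≤ Real.exp (M / 50))
    {N : ℕ} (hN : ∀ j : Fin N, 12 * r * (j : ℕ) ≤ d / 2) {V : Finset ℂ}
    (hV : ∀ z : ℂ, ‖z‖ ≤ R → ∃ v ∈ V, ‖v - z‖ ≤ 1) (hlow : ExistsLowCurve f R d M) :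
    ∃ w : Fin N → ℂ, (∀ j, w j ∈ V) ∧ (∀ i j, i ≠ j → 10 * r ≤ ‖w i - w j‖) ∧
      ∀ j z, ‖z‖ ≤ 2 * r → ‖f (w j + z)‖ * Real.exp (-‖w j + z‖ ^ 2 / 2) ≤ Real.exp (-M / 4) := by
  obtain ⟨γ, hγR, hdiam, hγ⟩ := hlow
  have hγR' : ∀ t, ‖γ t‖ ≤ R := fun t => by simpa using hγR t
  obtain ⟨t₀, t₁, ht⟩ := exists_lt_norm_sub (by linarith) hdiam
  have hτ : ∀ j : Fin N, ∃ t, ‖γ t - γ t₀‖ = 12 * r * (j : ℕ) := fun j =>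
    exists_norm_sub_eq γ (γ t₀) (t₀ := t₀) (t₁ := t₁)
      (by rw [sub_self, norm_zero]; positivity) ((hN j).trans ht.le)
  choose τ hτ using hτ
  choose w hwV hw using fun j => hV (γ (τ j)) (hγR' (τ j))
  refine ⟨w, hwV, fun i j hij => ?_, fun j z hz => ?_⟩
  · have h1 : 1 ≤ |((i : ℕ) : ℝ) - (j : ℕ)| := by
      have : (1 : ℤ) ≤ |((i : ℕ) : ℤ) - (j : ℕ)| := by
        apply Int.one_le_abs
        have := Fin.val_ne_of_ne hij
        omega
      exact_mod_cast this
    have h2 := abs_norm_sub_norm_le (γ (τ i) - γ t₀) (γ (τ j) - γ t₀)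
    rw [sub_sub_sub_cancel_right, hτ, hτ, ← mul_sub, abs_mul,
      abs_of_pos (by linarith : 0 < 12 * r)] at h2
    have h3 : 12 * r ≤ ‖γ (τ i) - γ (τ j)‖ := by nlinarith
    have e : γ (τ i) - γ (τ j) = (w i - w j) - (w i - γ (τ i)) + (w j - γ (τ j)) := by ring
    rw [e] at h3
    have h4 := norm_add_le ((w i - w j) - (w i - γ (τ i))) (w j - γ (τ j))
    have h5 := norm_sub_le (w i - w j) (w i - γ (τ i))
    linarith [hw i, hw j]
  · have hfar : ∃ t, r ≤ ‖γ t - γ (τ j)‖ := by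
      by_contra! hc
      have h1 := norm_sub_le (γ t₁ - γ (τ j)) (γ t₀ - γ (τ j))
      rw [sub_sub_sub_cancel_right] at h1
      linarith [hc t₁, hc t₀]
    obtain ⟨t, ht'⟩ := hfar
    refine normalized_le_exp_of_low_curve hf hM hr hrM hB hγ ht' (hw j) ?_ hz
    have := norm_le_insert' (w j) (γ (τ j))
    linarith [hw j, hγR' (τ j)]

lemma IsIIDStdComplexGaussian.measure_existsLowCurve_le {Ω : Type*} [MeasurableSpace Ω]
    {P : Measure Ω} [IsProbabilityMeasure P] {ξ : ℕ → Ω → ℂ} (h : IsIIDStdComplexGaussian P ξ)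
    {M r R d T : ℝ} (hM : 50 ≤ M) (hr : 1 ≤ r) (hrM : 100 * Real.exp 16 * r ^ 2 ≤ M)
    (hrd : 4 * r ≤ d) (hR : 0 ≤ R) (hT : 1 ≤ T) {N L : ℕ} (hL : L ≠ 0) (hLr : (L : ℝ) ≤ r ^ 2)
    (hN : N * Real.exp (-31 * r ^ 2) ≤ 1 / 2) (hNd : ∀ j : Fin N, 12 * r * (j : ℕ) ≤ d / 2)
    (hgrowth : ∀ x, 0 ≤ x → x ≤ R + 1 + 2 * Real.exp 8 * r →
      T * (((x ^ 2 + 1) ^ 2 + Real.exp 1) / 2) ≤ Real.exp (M / 50)) :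
    P {ω | ExistsLowCurve (gaussianEntire ξ ω) R d M}
      ≤ ENNReal.ofReal (6 * Real.exp (-T ^ 2 / 2)
        + ((2 * R + 5) ^ 2) ^ N * Real.exp (-M / 4) ^ (N * L)) := by
  classical
  have hr0 : 0 < r := by linarith
  obtain ⟨V, hVcard, hV⟩ := exists_unit_net R hR
  have hω₀ := Complex.isPrimitiveRoot_exp L hL
  set ω₀ := Complex.exp (2 * Real.pi * Complex.I / L)
  have hrM' : 100 * r ^ 2 ≤ M := by
    have : (1 : ℝ) ≤ Real.exp 16 := Real.one_le_exp (by norm_num)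
    nlinarith [sq_nonneg r]
  set W := (Fintype.piFinset fun _ : Fin N => V).filter
    fun w => ∀ i j, i ≠ j → 10 * r ≤ ‖w i - w j‖ with hW
  set E : (Fin N → ℂ) → Set Ω := fun w =>
    {ω | (∀ k : ℕ, ‖ξ k ω‖ ^ 2 ≤ T ^ 2 + k) ∧ ∀ a : Fin N × Fin L,
        ‖gaussianEntire ξ ω (w a.1 + r * ω₀ ^ (a.2 : ℕ))‖
          * Real.exp (-‖w a.1 + r * ω₀ ^ (a.2 : ℕ)‖ ^ 2 / 2) ≤ Real.exp (-M / 4)}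
  have hsub : {ω | ExistsLowCurve (gaussianEntire ξ ω) R d M}
      ⊆ {ω | ¬ ∀ k : ℕ, ‖ξ k ω‖ ^ 2 ≤ T ^ 2 + k} ∪ ⋃ w ∈ W, E w := by
    intro ω hlow
    by_cases hω : ∀ k : ℕ, ‖ξ k ω‖ ^ 2 ≤ T ^ 2 + k
    · right
      have hB : ∀ z, ‖z‖ ≤ R + 1 + 2 * Real.exp 8 * r →
          ‖gaussianEntire ξ ω z‖ * Real.exp (-‖z‖ ^ 2 / 2) ≤ Real.exp (M / 50) := fun z hz => by
        refine le_trans ?_ (hgrowth ‖z‖ (norm_nonneg _) hz)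
        have h1 := norm_entire_le (a := fun k => ξ k ω) hT hω z
        calc _ ≤ T * Real.exp (‖z‖ ^ 2 / 2) * (((‖z‖ ^ 2 + 1) ^ 2 + Real.exp 1) / 2)
              * Real.exp (-‖z‖ ^ 2 / 2) := by gcongr; exact h1
          _ = T * (((‖z‖ ^ 2 + 1) ^ 2 + Real.exp 1) / 2)
              * (Real.exp (‖z‖ ^ 2 / 2) * Real.exp (-‖z‖ ^ 2 / 2)) := by ring
          _ = _ := by
            rw [← Real.exp_add, neg_div, add_neg_cancel, Real.exp_zero, mul_one]
      obtain ⟨w, hwV, hwsep, hw⟩ := exists_separated_small_disks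
        (differentiable_entire (a := fun k => ξ k ω) hT hω) hM hr hrM hrd hB hNd hV hlow
      refine Set.mem_biUnion (x := w) ?_ ⟨hω, fun a => hw a.1 _ ?_⟩
      · exact Finset.mem_coe.2 (Finset.mem_filter.2 ⟨Fintype.mem_piFinset.2 hwV, hwsep⟩)
      · rw [norm_mul, norm_pow, hω₀.norm'_eq_one hL, one_pow, mul_one, Complex.norm_real,
          Real.norm_of_nonneg hr0.le]
        linarith
    · exact Or.inl hω
  have hWcard : (W.card : ℝ) ≤ ((2 * R + 5) ^ 2) ^ N := by
    have h1 : W.card ≤ V.card ^ N := by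
      refine (Finset.card_filter_le _ _).trans_eq ?_
      rw [Fintype.card_piFinset_const]
    calc (W.card : ℝ) ≤ (V.card : ℝ) ^ N := by exact_mod_cast h1
      _ ≤ _ := by gcongr
  have hE : ∀ w ∈ W, P (E w) ≤ ENNReal.ofReal (Real.exp (-M / 4) ^ (N * L)) := fun w hw =>
    h.measure_small_on_circles hω₀ hL hT hr0 hM hrM' hLr w (Finset.mem_filter.1 hw).2 hN
  refine (measure_mono hsub).trans ((measure_union_le _ _).trans ?_)
  rw [ENNReal.ofReal_add (by positivity) (by positivity)]
  refine add_le_add (h.measure_large_coeff T) ?_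
  refine (measure_biUnion_finset_le _ _).trans ((Finset.sum_le_sum hE).trans ?_)
  rw [Finset.sum_const, nsmul_eq_mul, ← ENNReal.ofReal_natCast, ← ENNReal.ofReal_mul (by positivity)]
  apply ENNReal.ofReal_le_ofReal
  gcongr

/-! ### Numerical estimates and choice of parameters -/

lemma rpow_three_halves {M : ℝ} (hM : 0 ≤ M) : M ^ (3 / 2 : ℝ) = M * Real.sqrt M := by
  rw [show (3 / 2 : ℝ) = 1 + 1 / 2 by norm_num, Real.rpow_add' hM (by norm_num), Real.rpow_one,
    Real.sqrt_eq_rpow]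

lemma hundred_mul_exp_le_one : 100 * (Real.exp (-11) ^ 2 * Real.exp 16) ≤ 1 := by
  have he11 : Real.exp (-11) ^ 2 * Real.exp 16 = Real.exp (-6) := by
    rw [← Real.exp_nat_mul, ← Real.exp_add]; norm_num
  have h3 : Real.exp 6 = Real.exp 1 ^ 6 := by rw [← Real.exp_nat_mul]; norm_num
  have h4 : (2.7 : ℝ) ≤ Real.exp 1 := by linarith [Real.exp_one_gt_d9]
  have h5 : (2.7 : ℝ) ^ 6 ≤ Real.exp 1 ^ 6 := by gcongr
  norm_num at h5
  rw [he11, Real.exp_neg, ← div_eq_mul_inv, div_le_one (Real.exp_pos _), h3]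
  linarith

lemma growth_factor_le {ρ M y : ℝ} (hρ : 2000 ≤ ρ) (hM : ρ ^ 20 ≤ Real.exp (M / 100))
    (hy0 : 0 ≤ y) (hy : y ≤ 2 * ρ ^ 4) :
    Real.exp (M / 100) * (((y ^ 2 + 1) ^ 2 + Real.exp 1) / 2) ≤ Real.exp (M / 50) := by
  have h4 : ((y ^ 2 + 1) ^ 2 + Real.exp 1) / 2 ≤ ρ ^ 20 := by
    have e1 : Real.exp 1 ≤ 3 := by linarith [Real.exp_one_lt_d9]
    have e2 : (1 : ℝ) ≤ ρ ^ 8 := one_le_pow₀ (by linarith)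
    have e3 : y ^ 2 ≤ 4 * ρ ^ 8 := by
      calc y ^ 2 ≤ (2 * ρ ^ 4) ^ 2 := by gcongr
        _ = _ := by ring
    have e4 : (y ^ 2 + 1) ^ 2 ≤ (5 * ρ ^ 8) ^ 2 :=
      pow_le_pow_left₀ (by positivity) (by linarith) 2
    have e5 : (2000 : ℝ) ^ 4 ≤ ρ ^ 4 := by gcongr
    have e6 : (1 : ℝ) ≤ ρ ^ 16 := one_le_pow₀ (by linarith)
    have e7 : (5 * ρ ^ 8) ^ 2 = 25 * ρ ^ 16 := by ring
    have e8 : ρ ^ 20 = ρ ^ 4 * ρ ^ 16 := by ring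
    have e9 : (14 : ℝ) * ρ ^ 16 ≤ ρ ^ 4 * ρ ^ 16 := by
      norm_num at e5
      exact mul_le_mul_of_nonneg_right (by linarith) (by linarith)
    rw [e8]
    linarith
  calc _ ≤ Real.exp (M / 100) * Real.exp (M / 100) := by gcongr; exact h4.trans hM
    _ = _ := by rw [← Real.exp_add]; congr 1; ring

lemma exp_neg_sq_le_half_exp_neg {ρ T A : ℝ} (hρ : 2000 ≤ ρ) (hA : A ≤ ρ ^ 5)
    (hT : ρ ^ 6 ≤ T ^ 2) : 6 * Real.exp (-T ^ 2 / 2) ≤ 1 / 2 * Real.exp (-A) := by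
  have h2 : A + 12 ≤ T ^ 2 / 2 := by
    have e1 : (1 : ℝ) ≤ ρ ^ 5 := one_le_pow₀ (by linarith)
    have e2 : 2000 * ρ ^ 5 ≤ ρ ^ 6 := by
      calc 2000 * ρ ^ 5 ≤ ρ * ρ ^ 5 := by gcongr
        _ = _ := by ring
    linarith
  have h3 : Real.exp (-12) ≤ 1 / 13 := by
    rw [Real.exp_neg, inv_le_comm₀ (Real.exp_pos _) (by norm_num)]
    linarith [Real.add_one_le_exp (12 : ℝ)]
  calc 6 * Real.exp (-T ^ 2 / 2) ≤ 6 * Real.exp (-A + -12) :=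
        mul_le_mul_of_nonneg_left (Real.exp_le_exp.2 (by linarith)) (by norm_num)
    _ = 6 * Real.exp (-12) * Real.exp (-A) := by rw [Real.exp_add]; ring
    _ ≤ _ := mul_le_mul_of_nonneg_right (by linarith) (Real.exp_pos _).le

/-- The entropy of one center, at most ρ^12 ≤ e^(M/8), uses up at most half of the gain e^(-LM/4) of
its circle because L ≥ 1. The 2 in `hA` pays for the factor 1/2. -/
lemma entropy_mul_exp_le_half_exp_neg {ρ M A : ℝ} {N L : ℕ} (hρ : 2000 ≤ ρ) (hM0 : 0 ≤ M)
    (hM : ρ ^ 12 ≤ Real.exp (M / 8)) (hL : (1 : ℝ) ≤ L) (hA1 : 1 ≤ A)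
    (hA : 2 * A ≤ N * (L * M / 8)) :
    ((2 * ρ ^ 4 + 5) ^ 2) ^ N * Real.exp (-M / 4) ^ (N * L) ≤ 1 / 2 * Real.exp (-A) := by
  have hhalf : Real.exp (-A) ≤ 1 / 2 := by
    rw [Real.exp_neg, inv_le_comm₀ (Real.exp_pos _) (by norm_num)]
    linarith [Real.add_one_le_exp A]
  have h1 : (2 * ρ ^ 4 + 5) ^ 2 ≤ Real.exp (M / 8) := by
    have e1 : (1 : ℝ) ≤ ρ ^ 4 := one_le_pow₀ (by linarith)
    have e3 : (2000 : ℝ) ^ 2 ≤ ρ ^ 2 := by gcongr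
    norm_num at e3
    have e2 : 2 * ρ ^ 4 + 5 ≤ ρ ^ 6 := by
      calc 2 * ρ ^ 4 + 5 ≤ 7 * ρ ^ 4 := by linarith
        _ ≤ ρ ^ 2 * ρ ^ 4 := mul_le_mul_of_nonneg_right (by linarith) (by linarith)
        _ = _ := by ring
    calc (2 * ρ ^ 4 + 5) ^ 2 ≤ (ρ ^ 6) ^ 2 := pow_le_pow_left₀ (by positivity) e2 2
      _ = ρ ^ 12 := by ring
      _ ≤ _ := hM
  have h2 : Real.exp (M / 8) * Real.exp (-M / 4) ^ L ≤ Real.exp (-(L * M / 8)) := by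
    rw [← Real.exp_nat_mul, ← Real.exp_add]
    refine Real.exp_le_exp.2 ?_
    have : M ≤ L * M := le_mul_of_one_le_left hM0 hL
    linarith
  calc ((2 * ρ ^ 4 + 5) ^ 2) ^ N * Real.exp (-M / 4) ^ (N * L)
      = ((2 * ρ ^ 4 + 5) ^ 2 * Real.exp (-M / 4) ^ L) ^ N := by
        rw [mul_comm N L, pow_mul (Real.exp _), ← mul_pow]
    _ ≤ (Real.exp (-(L * M / 8))) ^ N := by
        refine pow_le_pow_left₀ (by positivity) (le_trans ?_ h2) N
        exact mul_le_mul_of_nonneg_right h1 (by positivity)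
    _ = Real.exp (-(N * (L * M / 8))) := by rw [← Real.exp_nat_mul]; congr 1; ring
    _ ≤ Real.exp (-A + -A) := Real.exp_le_exp.2 (by linarith)
    _ = Real.exp (-A) * Real.exp (-A) := Real.exp_add _ _
    _ ≤ _ := mul_le_mul_of_nonneg_right hhalf (Real.exp_pos _).le

theorem theorem4p3 (β : ℝ) (hβ : 0 < β) :
    ∃ c : ℝ, 0 < c ∧ ∃ ρ₀ : ℝ, ∀ ρ : ℝ, ρ₀ ≤ ρ →
      ∀ M : ℝ, Real.log ρ ^ 2 ≤ M → M ≤ ρ ^ 2 →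
      ∀ (Ω : Type*) [MeasurableSpace Ω] (P : Measure Ω) [IsProbabilityMeasure P]
        (ξ : ℕ → Ω → ℂ), IsIIDStdComplexGaussian P ξ →
        P {ω | ExistsLowCurve (gaussianEntire ξ ω) (ρ ^ 4) (β * ρ) M}
          ≤ ENNReal.ofReal (Real.exp (-(c * ρ * M ^ (3 / 2 : ℝ)))) := by
  -- The bound e^(-11) gives 100 e^16 r² ≤ M, and β/4 gives 4r ≤ βρ.
  set a : ℝ := min (Real.exp (-11)) (β / 4) with ha
  have ha0 : 0 < a := by positivity
  have ha1 : a ≤ Real.exp (-11) := min_le_left _ _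
  have ha2 : a ≤ β / 4 := min_le_right _ _
  have hale : a ≤ 1 := ha1.trans (Real.exp_le_one_iff.2 (by norm_num))
  -- Chosen so that 2cρM^(3/2) = x(r²/2)(M/8) with x = βρ/(24r); 768 = 2·24·2·8.
  set c : ℝ := β * a / 768 with hc
  have hc0 : 0 < c := by positivity
  -- C bounds log ρ from below. Its terms secure, in order, the numerical inequalities, r² ≥ 2 log
  -- ρ, N exp(-31r²) ≤ 1/2 and A ≥ 1.
  set C : ℝ := 2000 + 2 / a ^ 2 + 2 * (β + 1) + 1 / c with hC
  have hCa : 2 ≤ a ^ 2 * C := by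
    have : a ^ 2 * (2 / a ^ 2) = 2 := by field_simp
    have : 0 ≤ a ^ 2 * (2000 + 2 * (β + 1) + 1 / c) := by positivity
    rw [hC]; linarith
  have hCc : 1 ≤ c * C := by
    have : c * (1 / c) = 1 := by field_simp
    have : 0 ≤ c * (2000 + 2 * (β + 1) + 2 / a ^ 2) := by positivity
    rw [hC]; linarith
  have hpos1 : 0 < 2 / a ^ 2 := by positivity
  have hpos2 : 0 < 1 / c := by positivity
  have hC2000 : 2000 ≤ C := by rw [hC]; linarith
  have hCβ : 2 * (β + 1) ≤ C := by rw [hC]; linarith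
  refine ⟨c, hc0, Real.exp C, fun ρ hρ M hM1 hM2 Ω _ P _ ξ h => ?_⟩
  have hρ0 : 0 < ρ := (Real.exp_pos _).trans_le hρ
  set ℓ := Real.log ρ with hℓ
  have hℓC : C ≤ ℓ := (Real.le_log_iff_exp_le hρ0).2 hρ
  have hexpℓ : Real.exp ℓ = ρ := Real.exp_log hρ0
  have hρpow : ∀ k : ℕ, ρ ^ k = Real.exp (k * ℓ) := fun k => by rw [Real.exp_nat_mul, hexpℓ]
  have hℓρ : ℓ + 1 ≤ ρ := by rw [← hexpℓ]; exact Real.add_one_le_exp ℓ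
  have hℓ0 : 0 < ℓ := by linarith
  -- The hypothesis log² ρ ≤ M enters only here, through M ≥ C log ρ.
  have hCM : C * ℓ ≤ M := le_trans (by rw [sq]; gcongr) hM1
  have hMℓ : 2000 * ℓ ≤ M := le_trans (by gcongr) hCM
  have hM2000 : 2000 ≤ M := by linarith
  have hM0 : 0 < M := by linarith
  have hsq0 : 0 < Real.sqrt M := Real.sqrt_pos.2 hM0
  have hsqρ : Real.sqrt M ≤ ρ := Real.sqrt_le_iff.2 ⟨hρ0.le, hM2⟩
  have hsq1 : 1 ≤ Real.sqrt M := Real.one_le_sqrt.2 (by linarith)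
  set r : ℝ := a * Real.sqrt M with hr
  have hr0 : 0 < r := by positivity
  have hr2 : r ^ 2 = a ^ 2 * M := by rw [hr, mul_pow, Real.sq_sqrt hM0.le]
  have hr2ℓ : 2 * ℓ ≤ r ^ 2 := by
    rw [hr2]
    calc 2 * ℓ ≤ a ^ 2 * C * ℓ := by gcongr
      _ = a ^ 2 * (C * ℓ) := by ring
      _ ≤ _ := by gcongr
  have hr1 : 1 ≤ r := by
    rw [← one_le_sq_iff₀ hr0.le]; linarith
  have hrρ : r ≤ a * ρ := by rw [hr]; gcongr
  have hrM : 100 * Real.exp 16 * r ^ 2 ≤ M := by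
    rw [hr2]
    have h1 : a ^ 2 * Real.exp 16 ≤ Real.exp (-11) ^ 2 * Real.exp 16 := by gcongr
    have h2 : 100 * (a ^ 2 * Real.exp 16) ≤ 1 := by linarith [hundred_mul_exp_le_one]
    calc 100 * Real.exp 16 * (a ^ 2 * M) = 100 * (a ^ 2 * Real.exp 16) * M := by ring
      _ ≤ 1 * M := by gcongr
      _ = M := one_mul M
  set x : ℝ := β * ρ / (24 * r) with hx
  have hx0 : 0 ≤ x := by positivity
  -- The added 1 gives N ≥ x, while the indices j < N still satisfy j ≤ x.
  set N : ℕ := ⌊x⌋₊ + 1 with hN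
  set L : ℕ := ⌊r ^ 2⌋₊ with hL
  have hr21 : 1 ≤ r ^ 2 := one_le_pow₀ hr1
  have hL0 : L ≠ 0 := (Nat.floor_pos.2 hr21).ne'
  have hL1 : (1 : ℝ) ≤ L := by exact_mod_cast Nat.one_le_iff_ne_zero.2 hL0
  have hLr : (L : ℝ) ≤ r ^ 2 := Nat.floor_le (by positivity)
  have hLr' : r ^ 2 / 2 ≤ L := by
    have := Nat.lt_floor_add_one (r ^ 2)
    rw [← hL] at this
    linarith
  have hNx : x ≤ N := by
    have := Nat.lt_floor_add_one x
    rw [hN]; push_cast; exact this.le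
  have hNρ : (N : ℝ) ≤ (β + 1) * ρ := by
    have h1 : (⌊x⌋₊ : ℝ) ≤ x := Nat.floor_le hx0
    have h2 : x ≤ β * ρ := by
      rw [hx, div_le_iff₀ (by positivity)]
      exact le_mul_of_one_le_right (by positivity) (by linarith)
    rw [hN, add_mul]; push_cast; linarith
  -- T takes half of the growth allowance e^(M/50), the rest absorbing the polynomial factor;
  -- exp(-T²/2) is negligible since T² ≥ ρ^6.
  set T : ℝ := Real.exp (M / 100) with hT
  have hT1 : 1 ≤ T := Real.one_le_exp (by positivity)
  have hmain := h.measure_existsLowCurve_le (R := ρ ^ 4) (d := β * ρ) (T := T) (N := N) (L := L)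
    (by linarith : (50 : ℝ) ≤ M) hr1 hrM
    (by
      have : a * ρ ≤ β / 4 * ρ := by gcongr
      linarith) (by positivity) hT1 hL0 hLr
    (by
      have h1 : Real.exp (-31 * r ^ 2) ≤ Real.exp (-(2 * ℓ)) :=
        Real.exp_le_exp.2 (by linarith)
      have h2 : Real.exp (-(2 * ℓ)) = (ρ ^ 2)⁻¹ := by rw [Real.exp_neg, hρpow 2]; norm_num
      calc (N : ℝ) * Real.exp (-31 * r ^ 2) ≤ ((β + 1) * ρ) * (ρ ^ 2)⁻¹ := by
            rw [← h2]; gcongr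
        _ = (β + 1) / ρ := by field_simp
        _ ≤ 1 / 2 := by rw [div_le_iff₀ hρ0]; linarith)
    (fun j => by
      have h1 : ((j : ℕ) : ℝ) ≤ ⌊x⌋₊ := by
        have := j.2
        exact_mod_cast (by omega : (j : ℕ) ≤ ⌊x⌋₊)
      have h2 : ((j : ℕ) : ℝ) ≤ x := h1.trans (Nat.floor_le hx0)
      calc 12 * r * ((j : ℕ) : ℝ) ≤ 12 * r * x := by gcongr
        _ = _ := by rw [hx]; field_simp; norm_num)
    (fun y hy0 hy => by
      have h1 : Real.exp 8 * r ≤ ρ := by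
        calc Real.exp 8 * r ≤ Real.exp 8 * (Real.exp (-11) * ρ) := by
              gcongr; exact hrρ.trans (by gcongr)
          _ = Real.exp (-3) * ρ := by rw [← mul_assoc, ← Real.exp_add]; norm_num
          _ ≤ 1 * ρ := by gcongr; exact Real.exp_le_one_iff.2 (by norm_num)
          _ = ρ := one_mul _
      have hρ2 : 2000 ≤ ρ := by linarith
      have h2 : y ≤ 2 * ρ ^ 4 := by
        have : 3 * ρ ≤ ρ ^ 4 := by
          have : (3 : ℝ) ≤ ρ ^ 3 := by
            calc (3 : ℝ) ≤ 2000 ^ 3 := by norm_num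
              _ ≤ _ := by gcongr
          calc 3 * ρ ≤ ρ ^ 3 * ρ := by gcongr
            _ = _ := by ring
        linarith
      have h3 : ρ ^ 20 ≤ Real.exp (M / 100) := by
        rw [hρpow]; exact Real.exp_le_exp.2 (by push_cast; linarith)
      exact growth_factor_le hρ2 h3 hy0 h2)
  refine hmain.trans (ENNReal.ofReal_le_ofReal ?_)
  rw [rpow_three_halves hM0.le]
  set A : ℝ := c * ρ * (M * Real.sqrt M) with hA
  have hAlow : 1 ≤ A := by
    have h1 : 1 ≤ c * ρ := hCc.trans (by gcongr; linarith)
    have h2 : 1 ≤ M * Real.sqrt M := one_le_mul_of_one_le_of_one_le (by linarith) hsq1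
    exact one_le_mul_of_one_le_of_one_le h1 h2
  have hρ2000 : 2000 ≤ ρ := by linarith
  have hAhigh : A ≤ ρ ^ 5 := by
    have h1 : c ≤ ρ := by
      have : c ≤ β := by
        have : β * a ≤ β := mul_le_of_le_one_right hβ.le hale
        rw [hc]; linarith
      linarith
    calc A ≤ ρ * ρ * (ρ ^ 2 * ρ) := by rw [hA]; gcongr
      _ = _ := by ring
  have hfirst : 6 * Real.exp (-T ^ 2 / 2) ≤ 1 / 2 * Real.exp (-A) := by
    refine exp_neg_sq_le_half_exp_neg hρ2000 hAhigh ?_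
    rw [hρpow, hT, ← Real.exp_nat_mul]
    exact Real.exp_le_exp.2 (by push_cast; linarith)
  have hsecond : ((2 * ρ ^ 4 + 5) ^ 2) ^ N * Real.exp (-M / 4) ^ (N * L)
      ≤ 1 / 2 * Real.exp (-A) := by
    refine entropy_mul_exp_le_half_exp_neg hρ2000 hM0.le ?_ hL1 hAlow ?_
    · rw [hρpow]
      exact Real.exp_le_exp.2 (by push_cast; linarith)
    · calc 2 * A = x * (r ^ 2 / 2 * M / 8) := by
            rw [hA, hc, hx, hr]; field_simp; norm_num
        _ ≤ _ := by gcongr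
  linarith
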